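/- **Definitions.** A metric space $X$ has *asymptotic dimension at most $n$* if for every uniformly bounded open cover $\mathcal V$ of $X$ there is a uniformly bounded open cover $\mathcal U$ of $X$ such that every point lies in at most $n+1$ members of $\mathcal U$ and every member of $\mathcal V$ is contained in a member of $\mathcal U$; $\mathrm{asdim}(X)\in\mathbb N\cup\{\infty\}$ is the least such $n$. For a graph, $\mathrm{asdim}$ refers to its vertex set with the graph distance (vertices in different components having distance $\infty$), and for a set of vertices to that distance restricted to the set. Let $G_1,G_2$ be graphs, $I_1,I_2$ disjoint sets, $(S^i_k)_{k\in I_i}$ a family of subsets of $V(G_i)$ for $i=1,2$, all of the same cardinality, and for $k\in I_1$, $\ell\in I_2$ let $\varphi_{k\ell}\colon S^1_k\to S^2_\ell$ be a bijection, with $\varphi_{\ell k}:=\varphi_{k\ell}^{-1}$ (the *bonding maps*). Let $T$ be a tree with bipartition $\{V_1,V_2\}$ of its vertex set, each edge $uv$ carrying a label $f(\overrightarrow{uv})$ for each of its two orientations, such that for every $v\in V_i$ the edges starting at $v$ have labels in $I_i$ and every $k\in I_i$ occurs precisely once among them. Take the disjoint union of copies $G_v$ of $G_i$, one for each $v\in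 V_i$, $i=1,2$, with copies $S^v_k$ of the sets $S^i_k$. For every edge $uv$ of $T$, with $k=f(\overrightarrow{uv})$ and $\ell=f(\overrightarrow{vu})$, join each $x\in S^u_k$ to $\varphi_{k\ell}(x)\in S^v_\ell$ by a new edge. The graph $G_1\ast G_2$ obtained by contracting all new edges (disregarding loops and parallel edges) is the *tree amalgamation*; let $\pi$ be the contraction map on vertices. The *adhesion sets* are the sets $S^i_k$ (in $G_i$) and the images $\pi(S^v_k)$ (in $G_1\ast G_2$). The tree amalgamation has *finite identification* if there is an $N\in\mathbb N$ such that for every vertex $x$ of $G_1\ast G_2$ at most $N$ of the copies $G_v$ meet $\pi^{-1}(x)$. Let groups $\Gamma_1,\Gamma_2$ act on $G_1,G_2$ by automorphisms, and let $R\subseteq I_1\times I_2$, read as a symmetric relation between $I_1$ and $I_2$. We say that *the bonding maps in $R$ are respected and consistent* if for $\{i,j\}=\{1,2\}$, in both orders: * for every $\gamma\in\Gamma_i$ there is a permutation $\sigma$ of $I_i$ such that for every $k\in I_i$ there are $\ell\in I_j$, with $k$ and $\sigma(k)$ both related to $\ell$ by $R$, and $\tau$ in the setwise stabiliser of $S^j_\ell$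 in $\Gamma_j$ such that $\gamma S^i_k\subseteq S^i_{\sigma(k)}$ and $\varphi_{k\ell}=\tau\circ\varphi_{\sigma(k)\ell}\circ\gamma|_{S^i_k}$; * for all $k\in I_i$ and $\ell,\ell'\in I_j$, both related to $k$ by $R$, there is $\gamma\in\Gamma_j$ with $\varphi_{k\ell}=\gamma\circ\varphi_{k\ell'}$. The tree amalgamation *respects the actions of $\Gamma_1$ and $\Gamma_2$* if one of the following holds. * (Type 1) The bonding maps in $R=I_1\times I_2$ are respected and consistent. * (Type 2) $G_1=G_2$ and $\Gamma_1=\Gamma_2$ with the same action, $I_1$ and $I_2$ are identified with one set $I$ by a bijection such that $S^1_k=S^2_k$ for all $k\in I$, and there is $J\subseteq I$ such that precisely one of the two labels of each edge of $T$ lies in $J$ and such that the bonding maps in $R$ are respected and consistent, where $R$ is the set of those pairs in $I_1\times I_2$ of which precisely one entry lies in $J$. **Theorem.** Let $G_1,G_2$ be locally finite connected graphs and let $\Gamma_1,\Gamma_2$ be groups acting on $G_1,G_2$, respectively, by automorphisms with finitely many vertex orbits. Let $G=G_1\ast G_2$ be a tree amalgamation of finite identification that respects the actions of $\Gamma_1$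 and $\Gamma_2$. Then, for every adhesion set $C$ of $G_1\ast G_2$, $$\mathrm{asdim}(G)\le\max\{\mathrm{asdim}(G_1),\ \mathrm{asdim}(G_2),\ \mathrm{asdim}(C)+1\}.$$ -/

import Mathlib

open scoped Pointwise

/-! ### Asymptotic dimension -/

/-- A family of subsets is uniformly bounded: the supremum of the diameters is finite. -/
def UniformlyBounded {X : Type*} [PseudoEMetricSpace X] (𝒱 : Set (Set X)) : Prop :=
  (⨆ A ∈ 𝒱, Metric.ediam A) < ⊤

/-- An open cover of `X`. -/
def OpenCover {X : Type*} [PseudoEMetricSpace X] (𝒱 : Set (Set X)) : Prop :=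
  (∀ A ∈ 𝒱, IsOpen A) ∧ ⋃₀ 𝒱 = Set.univ

/-- The multiplicity of the family is at most `m`: every point lies in at most `m` members. -/
def MultiplicityLE {X : Type*} (𝒰 : Set (Set X)) (m : ℕ) : Prop :=
  ∀ x : X, {A | A ∈ 𝒰 ∧ x ∈ A}.encard ≤ m

/-- `𝒰` refines `𝒱`. -/
def Refines {X : Type*} (𝒰 𝒱 : Set (Set X)) : Prop :=
  ∀ A ∈ 𝒰, ∃ B ∈ 𝒱, A ⊆ B

/-- `X` has asymptotic dimension at most `n`. -/
def AsdimLE (X : Type*) [PseudoEMetricSpace X] (n : ℕ) : Prop :=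
  ∀ 𝒱 : Set (Set X), OpenCover 𝒱 → UniformlyBounded 𝒱 →
    ∃ 𝒰 : Set (Set X), OpenCover 𝒰 ∧ UniformlyBounded 𝒰 ∧
      MultiplicityLE 𝒰 (n + 1) ∧ Refines 𝒱 𝒰

/-- The asymptotic dimension; it is `⊤` if no `n` bounds it. -/
noncomputable def asdim (X : Type*) [PseudoEMetricSpace X] : ℕ∞ :=
  ⨅ (n : ℕ) (_ : AsdimLE X n), (n : ℕ∞)

/-- The graph distance on the vertex set (`⊤` between different components). -/
@[reducible]
noncomputable def graphMetric {V : Type*} (G : SimpleGraph V) : PseudoEMetricSpace V where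
  edist x y := (G.edist x y : ENNReal)
  edist_self x := by simp
  edist_comm x y := by simp only [SimpleGraph.edist_comm]
  edist_triangle x y z := by
    rw [← ENat.toENNReal_add]
    exact ENat.toENNReal_le.2 SimpleGraph.edist_triangle

/-- The asymptotic dimension of a graph, i.e. of its vertex set with the graph distance. -/
noncomputable def graphAsdim {V : Type*} (G : SimpleGraph V) : ℕ∞ :=
  letI := graphMetric G
  asdim V

/-- The asymptotic dimension of a set `C` of vertices, with the distance of `G` restricted to `C`. -/
noncomputable def setAsdim {V : Type*} (G : SimpleGraph V) (C : Set V) : ℕ∞ :=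
  letI := graphMetric G
  asdim C

/-! ### Group actions on graphs -/

/-- The group `Γ` acts on the graph `G` by automorphisms. -/
def ActsOnGraph (Γ : Type*) {V : Type*} [Group Γ] [MulAction Γ V] (G : SimpleGraph V) : Prop :=
  ∀ (γ : Γ) (x y : V), G.Adj (γ • x) (γ • y) ↔ G.Adj x y

/-- The group `Γ` acts on the graph `G` by automorphisms, with finitely many vertex orbits. -/
def ActsQuasiTransitively (Γ : Type*) {V : Type*} [Group Γ] [MulAction Γ V]
    (G : SimpleGraph V) : Prop :=
  ActsOnGraph Γ G ∧ Finite (MulAction.orbitRel.Quotient Γ V)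

/-! ### Tree amalgamations -/

/-- The data of a tree amalgamation of a graph on `V₁` and a graph on `V₂`: the families of
adhesion sets, the bonding maps, and the labelled connecting tree, whose canonical bipartition
is into `W₁` and `W₂`. -/
structure AmalgamData (V₁ V₂ I₁ I₂ W₁ W₂ : Type*) where
  /-- the adhesion sets in the first graph -/
  S₁ : I₁ → Set V₁
  /-- the adhesion sets in the second graph -/
  S₂ : I₂ → Set V₂
  /-- the bonding maps -/
  φ : ∀ (k : I₁) (l : I₂), S₁ k ≃ S₂ l
  /-- the connecting tree -/
  tree : SimpleGraph (W₁ ⊕ W₂)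
  isTree : tree.IsTree
  bipartite : tree.IsBipartiteWith (Set.range Sum.inl) (Set.range Sum.inr)
  /-- `lab₁ u w` is the label of the directed tree edge from `u` to `w`
  (only used if `u` and `w` are adjacent) -/
  lab₁ : W₁ → W₂ → I₁
  /-- `lab₂ w u` is the label of the directed tree edge from `w` to `u`
  (only used if `u` and `w` are adjacent) -/
  lab₂ : W₂ → W₁ → I₂
  /-- every label in `I₁` occurs precisely once at the edges starting at `u` -/
  lab₁_unique : ∀ (u : W₁) (k : I₁), ∃! w : W₂, tree.Adj (Sum.inl u) (Sum.inr w) ∧ lab₁ u w = k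
  /-- every label in `I₂` occurs precisely once at the edges starting at `w` -/
  lab₂_unique : ∀ (w : W₂) (l : I₂), ∃! u : W₁, tree.Adj (Sum.inl u) (Sum.inr w) ∧ lab₂ w u = l

namespace AmalgamData

variable {V₁ V₂ I₁ I₂ W₁ W₂ : Type*}

/-- The disjoint union of copies of `G₁`, one for each node in `W₁`, and copies of `G₂`, one for
each node in `W₂`. -/
def copies (_D : AmalgamData V₁ V₂ I₁ I₂ W₁ W₂) (G₁ : SimpleGraph V₁) (G₂ : SimpleGraph V₂) :
    SimpleGraph ((W₁ × V₁) ⊕ (W₂ × V₂)) where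
  Adj
    | .inl p, .inl q => p.1 = q.1 ∧ G₁.Adj p.2 q.2
    | .inr p, .inr q => p.1 = q.1 ∧ G₂.Adj p.2 q.2
    | _, _ => False
  symm := ⟨by
    rintro (p | p) (q | q) h
    · exact ⟨h.1.symm, h.2.symm⟩
    · exact h
    · exact h
    · exact ⟨h.1.symm, h.2.symm⟩⟩
  loopless := ⟨by
    rintro (p | p) h
    · exact G₁.irrefl h.2
    · exact G₂.irrefl h.2⟩

/-- The vertex `x` in the copy at `u` is joined by a new edge to the vertex `y` in the copy
at `w`. -/
def Bond (D : AmalgamData V₁ V₂ I₁ I₂ W₁ W₂) (u : W₁) (x : V₁) (w : W₂) (y : V₂) : Prop :=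
  D.tree.Adj (Sum.inl u) (Sum.inr w) ∧
    ∃ hx : x ∈ D.S₁ (D.lab₁ u w), (D.φ (D.lab₁ u w) (D.lab₂ w u) ⟨x, hx⟩ : V₂) = y

/-- The graph that consists of the new edges between the copies. -/
def bonds (D : AmalgamData V₁ V₂ I₁ I₂ W₁ W₂) : SimpleGraph ((W₁ × V₁) ⊕ (W₂ × V₂)) where
  Adj
    | .inl p, .inr q => D.Bond p.1 p.2 q.1 q.2
    | .inr q, .inl p => D.Bond p.1 p.2 q.1 q.2
    | _, _ => False
  symm := ⟨by rintro (p | p) (q | q) h <;> exact h⟩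
  loopless := ⟨by rintro (p | p) h <;> exact h⟩

/-- The graph `G₁ + G₂`. -/
def plus (D : AmalgamData V₁ V₂ I₁ I₂ W₁ W₂) (G₁ : SimpleGraph V₁) (G₂ : SimpleGraph V₂) :
    SimpleGraph ((W₁ × V₁) ⊕ (W₂ × V₂)) :=
  D.copies G₁ G₂ ⊔ D.bonds

/-- The vertices of the tree amalgamation, obtained by contracting all the new edges. -/
abbrev Vertex (D : AmalgamData V₁ V₂ I₁ I₂ W₁ W₂) : Type _ :=
  D.bonds.ConnectedComponent

/-- The canonical map from the vertices of `G₁ + G₂` to those of the tree amalgamation. -/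
def proj (D : AmalgamData V₁ V₂ I₁ I₂ W₁ W₂) (x : (W₁ × V₁) ⊕ (W₂ × V₂)) : D.Vertex :=
  D.bonds.connectedComponentMk x

/-- The tree amalgamation: the graph obtained from `G₁ + G₂` by contracting all the new edges
(as a simple graph, so without loops and parallel edges). -/
def amalgam (D : AmalgamData V₁ V₂ I₁ I₂ W₁ W₂) (G₁ : SimpleGraph V₁) (G₂ : SimpleGraph V₂) :
    SimpleGraph D.Vertex where
  Adj a b := a ≠ b ∧ ∃ x y, D.proj x = a ∧ D.proj y = b ∧ (D.plus G₁ G₂).Adj x y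
  symm := ⟨fun _ _ ⟨hne, x, y, hx, hy, h⟩ => ⟨hne.symm, y, x, hy, hx, h.symm⟩⟩
  loopless := ⟨fun _ h => h.1 rfl⟩

/-- The node of the connecting tree whose copy contains the given vertex of `G₁ + G₂`. -/
def node : (W₁ × V₁) ⊕ (W₂ × V₂) → W₁ ⊕ W₂ :=
  Sum.map Prod.fst Prod.fst

/-- The nodes whose copies contain a vertex that is mapped to `a`; their number is the
identification size of `a`. -/
def nodesOf (D : AmalgamData V₁ V₂ I₁ I₂ W₁ W₂) (a : D.Vertex) : Set (W₁ ⊕ W₂) :=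
  {t | ∃ x, node x = t ∧ D.proj x = a}

/-- The identification sizes are bounded. -/
def FiniteIdentification (D : AmalgamData V₁ V₂ I₁ I₂ W₁ W₂) : Prop :=
  ∃ N : ℕ, ∀ a : D.Vertex, (D.nodesOf a).encard ≤ N

/-- The image in the tree amalgamation of the `k`-th adhesion set of the copy of the first graph
at `u`. -/
def image₁ (D : AmalgamData V₁ V₂ I₁ I₂ W₁ W₂) (u : W₁) (k : I₁) : Set D.Vertex :=
  (fun x => D.proj (Sum.inl (u, x))) '' D.S₁ k

/-- The image in the tree amalgamation of the `l`-th adhesion set of the copy of the second graph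
at `w`. -/
def image₂ (D : AmalgamData V₁ V₂ I₁ I₂ W₁ W₂) (w : W₂) (l : I₂) : Set D.Vertex :=
  (fun y => D.proj (Sum.inr (w, y))) '' D.S₂ l

end AmalgamData

/-! ### Tree amalgamations that respect group actions

In the following two definitions `V, I, S, Γ` belong to one of the two sides and `V', I', S', Γ'`
to the other one. The relation `R` says which pairs of labels are taken into account. -/

/-- `γ` is respected: there is a permutation `σ` of `I` such that for every `k` there are `l` and
an element `τ` of the setwise stabiliser of `S' l` with `φ k l = τ ∘ φ (σ k) l ∘ γ` on `S k`. -/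
def RespectsElement {V V' I I' Γ : Type*} (Γ' : Type*) [Group Γ] [MulAction Γ V] [Group Γ']
    [MulAction Γ' V'] {S : I → Set V} {S' : I' → Set V'} (φ : ∀ k l, S k ≃ S' l)
    (R : I → I' → Prop) (γ : Γ) : Prop :=
  ∃ σ : Equiv.Perm I, ∀ k : I, ∃ l : I', R k l ∧ R (σ k) l ∧
    ∃ τ ∈ MulAction.stabilizer Γ' (S' l), ∀ x : S k, ∃ hx : γ • (x : V) ∈ S (σ k),
      (φ k l x : V') = τ • (φ (σ k) l ⟨γ • (x : V), hx⟩ : V')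

/-- The bonding maps from any `k` to any `l` and `l'` are consistent:
`φ k l = γ ∘ φ k l'` for some `γ` in the group `Γ'`. -/
def ConsistentBonds {V V' I I' : Type*} (Γ' : Type*) [Group Γ'] [MulAction Γ' V']
    {S : I → Set V} {S' : I' → Set V'} (φ : ∀ k l, S k ≃ S' l) (R : I → I' → Prop) : Prop :=
  ∀ (k : I) (l l' : I'), R k l → R k l' →
    ∃ γ : Γ', ∀ x : S k, (φ k l x : V') = γ • (φ k l' x : V')

namespace AmalgamData

variable {V₁ V₂ I₁ I₂ W₁ W₂ : Type*}

/-- With respect to the bonding maps between labels related by `R`, all elements of both groups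
are respected, and the bonding maps are consistent in both directions. -/
def RespectsAndConsistent (D : AmalgamData V₁ V₂ I₁ I₂ W₁ W₂) (Γ₁ Γ₂ : Type*)
    [Group Γ₁] [MulAction Γ₁ V₁] [Group Γ₂] [MulAction Γ₂ V₂] (R : I₁ → I₂ → Prop) : Prop :=
  (∀ γ : Γ₁, RespectsElement Γ₂ D.φ R γ) ∧
  (∀ γ : Γ₂, RespectsElement Γ₁ (fun l k => (D.φ k l).symm) (fun l k => R k l) γ) ∧
  ConsistentBonds Γ₂ D.φ R ∧
  ConsistentBonds Γ₁ (fun l k => (D.φ k l).symm) (fun l k => R k l)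

/-- Type 1 respecting the actions: all pairs of labels are taken into account. -/
def IsType1 (D : AmalgamData V₁ V₂ I₁ I₂ W₁ W₂) (Γ₁ Γ₂ : Type*)
    [Group Γ₁] [MulAction Γ₁ V₁] [Group Γ₂] [MulAction Γ₂ V₂] : Prop :=
  D.RespectsAndConsistent Γ₁ Γ₂ (fun _ _ => True)

/-- Type 2 respecting the actions. The two graphs, with the group actions and the families of
adhesion sets, are identified through `α`, `β` and `ι`. There is a set `J` of labels such that
precisely one of the two labels of each tree edge lies in `J`. Hence only the bonding maps between
`J` and its complement occur in the tree amalgamation, and only these are taken into account. -/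
def IsType2 (D : AmalgamData V₁ V₂ I₁ I₂ W₁ W₂) (G₁ : SimpleGraph V₁) (G₂ : SimpleGraph V₂)
    (Γ₁ Γ₂ : Type*) [Group Γ₁] [MulAction Γ₁ V₁] [Group Γ₂] [MulAction Γ₂ V₂] : Prop :=
  ∃ (α : G₁ ≃g G₂) (β : Γ₁ ≃* Γ₂) (ι : I₁ ≃ I₂) (J : Set I₁),
    (∀ (γ : Γ₁) (x : V₁), α (γ • x) = β γ • α x) ∧
    (∀ k : I₁, D.S₂ (ι k) = α '' D.S₁ k) ∧
    (∀ (u : W₁) (w : W₂), D.tree.Adj (Sum.inl u) (Sum.inr w) →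
      (D.lab₁ u w ∈ J ↔ D.lab₂ w u ∉ ι '' J)) ∧
    D.RespectsAndConsistent Γ₁ Γ₂ (fun k l => k ∈ J ↔ l ∉ ι '' J)

/-- The tree amalgamation respects the actions of `Γ₁` on `G₁` and of `Γ₂` on `G₂`. -/
def RespectsActions (D : AmalgamData V₁ V₂ I₁ I₂ W₁ W₂) (G₁ : SimpleGraph V₁)
    (G₂ : SimpleGraph V₂) (Γ₁ Γ₂ : Type*) [Group Γ₁] [MulAction Γ₁ V₁] [Group Γ₂]
    [MulAction Γ₂ V₂] : Prop :=
  D.IsType1 Γ₁ Γ₂ ∨ D.IsType2 G₁ G₂ Γ₁ Γ₂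

end AmalgamData

/-! The dimension hypotheses enter through colourings: asymptotic dimension at most `m` gives, at
every scale `r`, a colouring with `m + 1` colours whose monochromatic `r`-chains are bounded.
Finitely many orbits, local finiteness and finite identification leave, up to the actions, finitely
many pairs at distance at most `r` in adhesion sets. Hence the bonding maps are uniform coarse
equivalences (`exists_within_of_respectsElement`), and colourings of one adhesion set yield uniform
colourings of all (`RespectsActions.exists_rel`, `exists_uniform_hasColoring`). The copies are
uniformly coarsely embedded (`CoarseBonds.exists_copy_within`), because a walk that leaves a copy
along a tree edge returns along the same edge.

From then on the groups play no role. Root the tree and cut the amalgam near adhesion sets at widely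
spaced depths. A piece between consecutive cuts lies near boundedly many levels below one node, and
a union argument colours these with `n + 1` colours (`CoarseBonds.hasColoring_levels`). The
neighbourhood of the cuts splits into distant parts, each near one adhesion set, so `n` colours
suffice as soon as `n` is at least the dimension of an adhesion set plus one.

Gluing costs no extra dimension (`exists_cover_of_partition`): a boundary component of colour `j` is
used up to a height that grows with `j`, and sets of the pieces take over from there. At a low point
each `j < n` accounts for one boundary set or one piece set, and at most one `j` for both, which
gives multiplicity `n + 1`. -/

/-! ### Bounded distances in graphs -/

namespace SimpleGraph

variable {V V' : Type*}

/-- The vertices `x` and `y` are at distance at most `r`. -/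
def Within (G : SimpleGraph V) (r : ℕ) (x y : V) : Prop := G.edist x y ≤ r

variable {G : SimpleGraph V} {x y z : V} {r s t : ℕ}

lemma Within.refl (G : SimpleGraph V) (r : ℕ) (x : V) : G.Within r x x := by simp [Within]

lemma Within.symm (h : G.Within r x y) : G.Within r y x := by
  rwa [Within, edist_comm]

lemma Within.mono (h : G.Within r x y) (hrs : r ≤ s) : G.Within s x y :=
  le_trans h (by exact_mod_cast hrs)

lemma Within.trans (hxy : G.Within r x y) (hyz : G.Within s y z) (h : r + s ≤ t) :
    G.Within t x z := by
  refine le_trans SimpleGraph.edist_triangle ((add_le_add hxy hyz).trans ?_)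
  exact_mod_cast h

lemma Walk.within (w : G.Walk x y) (h : w.length ≤ r) : G.Within r x y :=
  (edist_le w).trans (by exact_mod_cast h)

lemma Within.exists_walk (h : G.Within r x y) : ∃ w : G.Walk x y, w.length ≤ r := by
  have hne : G.edist x y ≠ ⊤ := ne_top_of_le_ne_top (ENat.natCast_ne_top r) h
  obtain ⟨w, hw⟩ := exists_walk_of_edist_ne_top hne
  refine ⟨w, ?_⟩
  rw [Within, ← hw] at h
  exact_mod_cast h

lemma Adj.within (h : G.Adj x y) : G.Within 1 x y := h.toWalk.within (by simp)

lemma within_zero_iff : G.Within 0 x y ↔ x = y := by simp [Within]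

lemma Connected.exists_within (h : G.Connected) (x y : V) : ∃ r, G.Within r x y := by
  obtain ⟨w⟩ := h.preconnected x y
  exact ⟨w.length, w.within le_rfl⟩

lemma Within.map {G' : SimpleGraph V'} (f : V → V') (hf : ∀ a b, G.Adj a b → G'.Adj (f a) (f b))
    (h : G.Within r x y) : G'.Within r (f x) (f y) := by
  obtain ⟨w, hw⟩ := h.exists_walk
  let F : G →g G' := ⟨f, fun {a b} => hf a b⟩
  exact Walk.within (w.map F) (by simpa using hw)

/-- A function that changes by at most `K` along edges changes by at most `K * r` over distances
at most `r`. -/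
lemma Within.le_add_mul {f : V → ℕ} {K : ℕ} (hf : ∀ a b, G.Adj a b → f a ≤ f b + K)
    (h : G.Within r x y) : f x ≤ f y + K * r := by
  obtain ⟨w, hw⟩ := h.exists_walk
  have key : ∀ {x y : V} (w : G.Walk x y), f x ≤ f y + K * w.length := by
    intro x y w
    induction w with
    | nil => simp
    | cons hadj w ih =>
      have := hf _ _ hadj
      simp only [Walk.length_cons, mul_add]
      omega
  exact (key w).trans (by gcongr)

/-- A walk that leaves a set can be split at an edge where it does so. -/
lemma Walk.exists_exit (S : Set V) {x y : V} (w : G.Walk x y) (hx : x ∈ S) (hy : y ∉ S) :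
    ∃ a b, a ∈ S ∧ b ∉ S ∧ G.Adj a b ∧ ∃ (w₁ : G.Walk x a) (w₂ : G.Walk b y),
      w₁.length + 1 + w₂.length = w.length := by
  induction w with
  | nil => exact absurd hx hy
  | @cons u v _ hadj w ih =>
    by_cases hv : v ∈ S
    · obtain ⟨a, b, ha, hb, hab, w₁, w₂, hlen⟩ := ih hv hy
      exact ⟨a, b, ha, hb, hab, .cons hadj w₁, w₂, by simp only [Walk.length_cons]; omega⟩
    · exact ⟨u, v, hx, hv, hadj, .nil, w, by simp only [Walk.length_cons, Walk.length_nil]; omega⟩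

lemma finite_setOf_within (hfin : ∀ x, (G.neighborSet x).Finite) (r : ℕ) (x : V) :
    {y | G.Within r x y}.Finite := by
  induction r with
  | zero => simp [within_zero_iff]
  | succ r ih =>
    refine (ih.union (ih.biUnion fun y _ => hfin y)).subset fun z hz => ?_
    obtain ⟨w, hw⟩ := Within.exists_walk (Within.symm hz)
    cases w with
    | nil => exact Or.inl (Within.refl G r _)
    | @cons _ v _ hadj w =>
      refine Or.inr (Set.mem_biUnion (x := v) ?_ hadj.symm)
      exact (w.within (by simpa using hw)).symm

/-! ### Colourings with bounded monochromatic chains -/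

/-- One step of a monochromatic `r`-chain in `A`. -/
def ChainStep (G : SimpleGraph V) (A : Set V) (c : V → ℕ) (r : ℕ) (a b : V) : Prop :=
  a ∈ A ∧ b ∈ A ∧ c a = c b ∧ G.Within r a b

/-- Two vertices are joined by a monochromatic `r`-chain in `A`. -/
abbrev Chain (G : SimpleGraph V) (A : Set V) (c : V → ℕ) (r : ℕ) : V → V → Prop :=
  Relation.ReflTransGen (G.ChainStep A c r)

/-- The set `A` can be coloured with `m` colours such that the ends of any monochromatic `r`-chain
are at distance at most `D`. -/
def HasColoring (G : SimpleGraph V) (A : Set V) (m r D : ℕ) : Prop :=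
  ∃ c : V → ℕ, (∀ x ∈ A, c x < m) ∧ ∀ x y, G.Chain A c r x y → G.Within D x y

lemma ChainStep.symm {A : Set V} {c : V → ℕ} {a b : V} (h : G.ChainStep A c r a b) :
    G.ChainStep A c r b a :=
  ⟨h.2.1, h.1, h.2.2.1.symm, h.2.2.2.symm⟩

lemma Chain.symm {A : Set V} {c : V → ℕ} {a b : V} (h : G.Chain A c r a b) :
    G.Chain A c r b a := by
  induction h with
  | refl => exact .refl
  | tail _ hbc ih => exact ih.head hbc.symm

lemma Chain.mem_iff {A : Set V} {c : V → ℕ} {a b : V} (h : G.Chain A c r a b) :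
    a ∈ A ↔ b ∈ A := by
  induction h with
  | refl => rfl
  | tail _ hbc ih => exact ih.trans ⟨fun _ => hbc.2.1, fun _ => hbc.1⟩

lemma Chain.color_eq {A : Set V} {c : V → ℕ} {a b : V} (h : G.Chain A c r a b) :
    c a = c b := by
  induction h with
  | refl => rfl
  | tail _ hbc ih => exact ih.trans hbc.2.2.1

lemma HasColoring.mono {A B : Set V} {m m' r r' D D' : ℕ} (h : G.HasColoring B m r D)
    (hA : A ⊆ B) (hm : m ≤ m') (hr : r' ≤ r) (hD : D ≤ D') : G.HasColoring A m' r' D' := by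
  obtain ⟨c, hc, hb⟩ := h
  refine ⟨c, fun x hx => (hc x (hA hx)).trans_le hm, fun x y hxy => (hb x y ?_).mono hD⟩
  exact Relation.ReflTransGen.mono (fun a b ⟨ha, hb, hab, hw⟩ => ⟨hA ha, hA hb, hab, hw.mono hr⟩)
    _ _ hxy

/-- Only one implication is needed for the scales and one for the bounds, so `f` may be an isometric
embedding, a coarse equivalence or a choice of nearby points. -/
lemma HasColoring.transfer {G' : SimpleGraph V'} {A : Set V} {B : Set V'} {m r r' D D' : ℕ}
    (h : G'.HasColoring B m r' D') (f : V → V') (hf : ∀ x ∈ A, f x ∈ B)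
    (hr : ∀ x ∈ A, ∀ y ∈ A, G.Within r x y → G'.Within r' (f x) (f y))
    (hD : ∀ x ∈ A, ∀ y ∈ A, G'.Within D' (f x) (f y) → G.Within D x y) :
    G.HasColoring A m r D := by
  obtain ⟨c, hc, hb⟩ := h
  refine ⟨c ∘ f, fun x hx => hc _ (hf x hx), fun x y hxy => ?_⟩
  by_cases hx : x ∈ A
  · refine hD x hx y (hxy.mem_iff.1 hx) (hb _ _ ?_)
    exact Relation.ReflTransGen.lift f
      (fun a b hab => ⟨hf a hab.1, hf b hab.2.1, hab.2.2.1, hr a hab.1 b hab.2.1 hab.2.2.2⟩) _ _ hxy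
  · rcases hxy.cases_head with rfl | ⟨z, hz, _⟩
    · exact Within.refl G _ _
    · exact absurd hz.1 hx

/-- A coloring of `B` induces one of every set in a neighbourhood of `B`. -/
lemma HasColoring.of_near {A B : Set V} {m r s D : ℕ} (h : G.HasColoring B m (r + 2 * s) D)
    (hAB : ∀ x ∈ A, ∃ b ∈ B, G.Within s x b) : G.HasColoring A m r (D + 2 * s) := by
  choose! f hfB hfs using hAB
  refine h.transfer f hfB (fun x hx y hy hxy => ?_) (fun x hx y hy hxy => ?_)
  · exact ((hfs x hx).symm.trans hxy le_rfl).trans (hfs y hy) (by omega)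
  · exact ((hfs x hx).trans hxy le_rfl).trans (hfs y hy).symm (by omega)

/-- Colorings of pieces that are more than `r` apart from each other can be put together. -/
lemma HasColoring.of_separated {ι : Type*} {A : Set V} {m r D : ℕ} (lab : V → ι)
    (hlab : ∀ x ∈ A, ∀ y ∈ A, G.Within r x y → lab x = lab y)
    (h : ∀ i, G.HasColoring (A ∩ lab ⁻¹' {i}) m r D) : G.HasColoring A m r D := by
  choose c hc hb using h
  refine ⟨fun x => c (lab x) x, fun x hx => hc _ x ⟨hx, rfl⟩, fun x y hxy => hb (lab x) x y ?_⟩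
  have key : lab x = lab y ∧ G.Chain (A ∩ lab ⁻¹' {lab x}) (c (lab x)) r x y := by
    induction hxy with
    | refl => exact ⟨rfl, .refl⟩
    | @tail u v _ huv ih =>
      have h1 : lab u = lab v := hlab u huv.1 v huv.2.1 huv.2.2.2
      refine ⟨ih.1.trans h1, ih.2.tail ⟨⟨huv.1, ih.1.symm⟩, ⟨huv.2.1, (ih.1.trans h1).symm⟩, ?_,
        huv.2.2.2⟩⟩
      have := huv.2.2.1
      simp only [← h1, ← ih.1] at this
      exact this
  exact key.2

/-- The union of two sets, one of which is coloured at a scale that is large compared with the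
bound for the other one. -/
lemma HasColoring.union {A B : Set V} {m r d D : ℕ} (hB : G.HasColoring B m r d)
    (hA : G.HasColoring A m (d + 2 * r) D) : G.HasColoring (A ∪ B) m r (D + 2 * (d + r)) := by
  classical
  obtain ⟨cA, hcA, hbA⟩ := hA
  obtain ⟨cB, hcB, hbB⟩ := hB
  -- The colour from `A` takes precedence. Between consecutive visits to `A`, an `r`-chain advances
  -- at most `r + d + r`, by the bound for `B`; so its vertices in `A` form a `(d + 2 * r)`-chain.
  let c : V → ℕ := fun x => if x ∈ A then cA x else cB x
  have cA_eq : ∀ {x}, x ∈ A → c x = cA x := fun {x} hx => if_pos hx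
  have cB_eq : ∀ {x}, x ∉ A → c x = cB x := fun {x} hx => if_neg hx
  refine ⟨c, fun x hx => ?_, fun x y hxy => ?_⟩
  · by_cases hxA : x ∈ A
    · rw [cA_eq hxA]; exact hcA x hxA
    · rw [cB_eq hxA]; exact hcB x (hx.resolve_left hxA)
  have stepB : ∀ {a b}, a ∉ A → b ∉ A → G.ChainStep (A ∪ B) c r a b → G.ChainStep B cB r a b := by
    intro a b ha hb hab
    refine ⟨hab.1.resolve_left ha, hab.2.1.resolve_left hb, ?_, hab.2.2.2⟩
    rw [← cB_eq ha, ← cB_eq hb]; exact hab.2.2.1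
  -- Either the chain has avoided `A` so far, or `a` and `a'` are its first and last vertices in
  -- `A`, the latter possibly followed by a chain in `B`.
  have key : (y ∉ A ∧ G.Chain B cB r x y) ∨
      ∃ a a', a ∈ A ∧ a' ∈ A ∧ G.Within (d + r) x a ∧ G.Chain A cA (d + 2 * r) a a' ∧ c a' = c y ∧
        (a' = y ∨ y ∉ A ∧ ∃ b, G.Within r a' b ∧ G.Chain B cB r b y) := by
    induction hxy with
    | refl =>
      by_cases hx : x ∈ A
      · exact Or.inr ⟨x, x, hx, hx, Within.refl G _ x, .refl, rfl, Or.inl rfl⟩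
      · exact Or.inl ⟨hx, .refl⟩
    | @tail u v _ huv ih =>
      rcases ih with ⟨hu, hxu⟩ | ⟨a, a', ha, ha', hxa, haa', hcu, hu⟩
      · by_cases hv : v ∈ A
        · exact Or.inr ⟨v, v, hv, hv, (hbB _ _ hxu).trans huv.2.2.2 le_rfl, .refl, rfl, Or.inl rfl⟩
        · exact Or.inl ⟨hv, hxu.tail (stepB hu hv huv)⟩
      · have hcv : c a' = c v := hcu.trans huv.2.2.1
        by_cases hv : v ∈ A
        · refine Or.inr ⟨a, v, ha, hv, hxa, haa'.tail ⟨ha', hv, ?_, ?_⟩, rfl, Or.inl rfl⟩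
          · rw [← cA_eq ha', ← cA_eq hv]; exact hcv
          · rcases hu with rfl | ⟨_, b, hb, hbu⟩
            · exact huv.2.2.2.mono (by omega)
            · exact (hb.trans (hbB _ _ hbu) le_rfl).trans huv.2.2.2 (by omega)
        · refine Or.inr ⟨a, a', ha, ha', hxa, haa', hcv, Or.inr ⟨hv, ?_⟩⟩
          rcases hu with rfl | ⟨hu, b, hb, hbu⟩
          · exact ⟨v, huv.2.2.2, .refl⟩
          · exact ⟨b, hb, hbu.tail (stepB hu hv huv)⟩
  rcases key with ⟨_, hxy⟩ | ⟨a, a', -, -, hxa, haa', -, hy⟩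
  · exact (hbB _ _ hxy).mono (by omega)
  · have h1 := hxa.trans (hbA _ _ haa') le_rfl
    rcases hy with rfl | ⟨_, b, hb, hby⟩
    · exact h1.mono (by omega)
    · exact (h1.trans hb le_rfl).trans (hbB _ _ hby) (by omega)

end SimpleGraph

/-! ### Asymptotic dimension in terms of colourings -/

/-- In a space of asymptotic dimension at most `n` there are, at every scale `r`, colourings with
`n + 1` colours for which the monochromatic `r`-chains are uniformly bounded. -/
lemma AsdimLE.exists_coloring {X : Type*} [PseudoEMetricSpace X] {n : ℕ} (h : AsdimLE X n)
    (r : ℕ) : ∃ (D : ℕ) (c : X → ℕ), (∀ x, c x < n + 1) ∧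
      ∀ x y, Relation.ReflTransGen (fun a b => c a = c b ∧ edist a b ≤ r) x y → edist x y ≤ D := by
  classical
  set L : ENNReal := (((n + 1) * r + 1 : ℕ) : ENNReal) with hL
  have hLtop : L ≠ ⊤ := ENNReal.natCast_ne_top _
  obtain ⟨𝒰, hcov, hbdd, hmult, href⟩ := h (Set.range fun x : X => Metric.eball x L)
    ⟨by rintro _ ⟨x, rfl⟩; exact Metric.isOpen_eball, by
      refine Set.eq_univ_of_forall fun x => ⟨_, ⟨x, rfl⟩, Metric.mem_eball_self ?_⟩
      simp [hL]⟩
    (by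
      refine lt_of_le_of_lt (b := 2 * L) (iSup₂_le ?_) (ENNReal.mul_lt_top (by simp) hLtop.lt_top)
      rintro _ ⟨x, rfl⟩
      exact Metric.ediam_eball_le)
  obtain ⟨D, hD⟩ := ENNReal.exists_nat_gt hbdd.ne
  let S : ℕ → X → Set (Set X) := fun j x => {U | U ∈ 𝒰 ∧ ∀ y, edist x y ≤ (j * r : ℕ) → y ∈ U}
  have hS0 : ∀ x, S 0 x ⊆ {U | U ∈ 𝒰 ∧ x ∈ U} := fun x U hU => ⟨hU.1, hU.2 x (by simp)⟩
  have hSanti : ∀ j x, S (j + 1) x ⊆ S j x := fun j x U hU =>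
    ⟨hU.1, fun y hy => hU.2 y (hy.trans (by gcongr; omega))⟩
  have hSS0 : ∀ j x, S j x ⊆ S 0 x := by
    intro j x
    induction j with
    | zero => exact subset_rfl
    | succ j ih => exact (hSanti j x).trans ih
  have hfin0 : ∀ x, (S 0 x).Finite := fun x => Set.finite_of_encard_le_coe
    ((Set.encard_le_encard (hS0 x)).trans (hmult x))
  have hcard0 : ∀ x, (S 0 x).ncard ≤ n + 1 := fun x => by
    have := (Set.encard_le_encard (hS0 x)).trans (hmult x)
    rw [← (hfin0 x).cast_ncard_eq] at this
    exact_mod_cast this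
  have hne : ∀ x, (S (n + 1) x).Nonempty := by
    intro x
    obtain ⟨U, hU, hxU⟩ := href _ ⟨x, rfl⟩
    refine ⟨U, hU, fun y hy => hxU ?_⟩
    rw [Metric.mem_eball, edist_comm]
    refine lt_of_le_of_lt hy ?_
    rw [hL]
    exact_mod_cast Nat.lt_succ_self _
  -- The sets `S 0 x ⊇ ... ⊇ S (n + 1) x` start with at most `n + 1` members and end nonempty, so
  -- one of the `n + 1` inclusions is an equality. Its index is the colour.
  have hex : ∀ x, ∃ j, j < n + 1 ∧ S j x ⊆ S (j + 1) x := by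
    intro x
    by_contra! hcon
    have key : ∀ i ≤ n + 1, (S i x).ncard + i ≤ n + 1 := by
      intro i
      induction i with
      | zero => intro _; simpa using hcard0 x
      | succ i ih =>
        intro hi
        have h1 := ih (by omega)
        have h2 : (S (i + 1) x).ncard < (S i x).ncard :=
          Set.ncard_lt_ncard ⟨hSanti i x, hcon i (by omega)⟩ ((hfin0 x).subset (hSS0 i x))
        omega
    have h1 := key (n + 1) le_rfl
    have h2 : 0 < (S (n + 1) x).ncard :=
      (Set.ncard_pos ((hfin0 x).subset (hSS0 _ x))).2 (hne x)
    omega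
  choose c hc hcS using hex
  -- A set containing the ball of radius `(j + 1) * r` about `a` contains that of radius `j * r`
  -- about `b`; for `j = c b` the next larger ball is then contained as well. Thus members persist
  -- along chains, and both ends lie in a common one.
  have hstep : ∀ a b, c a = c b → edist a b ≤ r → S (c a + 1) a ⊆ S (c b + 1) b := by
    intro a b hab hr U hU
    refine hcS b ⟨hU.1, fun y hy => hU.2 y ?_⟩
    refine (edist_triangle a b y).trans ((add_le_add hr hy).trans ?_)
    rw [← hab]
    exact_mod_cast (by ring_nf; rfl : r + c a * r ≤ (c a + 1) * r)
  refine ⟨D, c, hc, fun x y hxy => ?_⟩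
  have hsub : S (c x + 1) x ⊆ S (c y + 1) y := by
    induction hxy with
    | refl => exact subset_rfl
    | tail _ hbc ih => exact ih.trans (hstep _ _ hbc.1 hbc.2)
  have hmono : S (n + 1) x ⊆ S (c x + 1) x := by
    have : ∀ i j, i ≤ j → S j x ⊆ S i x := fun i j hij => by
      induction hij with
      | refl => exact subset_rfl
      | step _ ih => exact (hSanti _ x).trans ih
    exact this _ _ (hc x)
  obtain ⟨U, hU⟩ := hne x
  have hxU := (hSS0 _ x (hmono hU)).2 x (by simp)
  have hyU := (hSS0 _ y (hsub (hmono hU))).2 y (by simp)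
  refine (Metric.edist_le_ediam_of_mem hxU hyU).trans (le_trans ?_ hD.le)
  exact le_iSup₂ (f := fun A (_ : A ∈ 𝒰) => Metric.ediam A) U hU.1

/-- A finite infimum of natural numbers is attained: otherwise every admissible `m` exceeds it by at
least one. -/
lemma exists_asdimLE_of_asdim_ne_top {X : Type*} [PseudoEMetricSpace X] (h : asdim X ≠ ⊤) :
    ∃ m : ℕ, AsdimLE X m ∧ (m : ℕ∞) ≤ asdim X := by
  by_contra! hcon
  obtain ⟨b, hb⟩ := ENat.ne_top_iff_exists.1 h
  rw [← hb] at hcon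
  have : ((b + 1 : ℕ) : ℕ∞) ≤ asdim X := le_iInf₂ fun m hm => by
    have := hcon m hm
    exact_mod_cast this
  rw [← hb] at this
  norm_cast at this
  omega

namespace SimpleGraph

variable {V : Type*} {G : SimpleGraph V}

lemma graphMetric_edist_le_iff (r : ℕ) (x y : V) :
    letI := graphMetric G; (EDist.edist x y ≤ (r : ENNReal)) ↔ G.Within r x y := by
  change ((G.edist x y : ENNReal) ≤ r) ↔ _
  rw [Within, ← ENat.toENNReal_coe, ENat.toENNReal_le]

lemma exists_hasColoring_of_asdimLE {A : Set V} {n : ℕ}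
    (h : letI := graphMetric G; AsdimLE A n) (r : ℕ) : ∃ D, G.HasColoring A (n + 1) r D := by
  classical
  let := graphMetric G
  obtain ⟨D, c, hc, hb⟩ := AsdimLE.exists_coloring h r
  refine ⟨D, fun x => if hx : x ∈ A then c ⟨x, hx⟩ else 0, fun x hx => ?_, fun x y hxy => ?_⟩
  · simpa [hx] using hc ⟨x, hx⟩
  by_cases hx : x ∈ A
  · have hy := hxy.mem_iff.1 hx
    rw [← graphMetric_edist_le_iff]
    refine hb ⟨x, hx⟩ ⟨y, hy⟩ ?_
    clear hb
    induction hxy with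
    | refl => exact .refl
    | @tail u v _ huv ih =>
      refine (ih huv.1).tail ⟨?_, (graphMetric_edist_le_iff r _ _).2 huv.2.2.2⟩
      simpa [huv.1, huv.2.1] using huv.2.2.1
  · rcases hxy.cases_head with rfl | ⟨z, hz, _⟩
    · exact Within.refl G _ _
    · exact absurd hz.1 hx

lemma exists_hasColoring_univ_of_asdimLE {n : ℕ}
    (h : letI := graphMetric G; AsdimLE V n) (r : ℕ) :
    ∃ D, G.HasColoring Set.univ (n + 1) r D := by
  let := graphMetric G
  obtain ⟨D, c, hc, hb⟩ := AsdimLE.exists_coloring h r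
  refine ⟨D, c, fun x _ => hc x, fun x y hxy => ?_⟩
  rw [← graphMetric_edist_le_iff]
  exact hb x y (Relation.ReflTransGen.mono
    (fun a b hab => ⟨hab.2.2.1, (graphMetric_edist_le_iff r _ _).2 hab.2.2.2⟩) _ _ hxy)

lemma exists_hasColoring_of_setAsdim_ne_top {A : Set V} (h : setAsdim G A ≠ ⊤) :
    ∃ n : ℕ, (n : ℕ∞) ≤ setAsdim G A ∧ ∀ r, ∃ D, G.HasColoring A (n + 1) r D := by
  let := graphMetric G
  obtain ⟨n, hn, hle⟩ := exists_asdimLE_of_asdim_ne_top (X := A) h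
  exact ⟨n, hle, exists_hasColoring_of_asdimLE hn⟩

lemma exists_hasColoring_of_graphAsdim_ne_top (h : graphAsdim G ≠ ⊤) :
    ∃ n : ℕ, (n : ℕ∞) ≤ graphAsdim G ∧ ∀ r, ∃ D, G.HasColoring Set.univ (n + 1) r D := by
  let := graphMetric G
  obtain ⟨n, hn, hle⟩ := exists_asdimLE_of_asdim_ne_top (X := V) h
  exact ⟨n, hle, exists_hasColoring_univ_of_asdimLE hn⟩

lemma isOpen_graphMetric (A : Set V) : letI := graphMetric G; IsOpen A := by
  let := graphMetric G
  refine EMetric.isOpen_iff.2 fun x hx => ⟨1, by simp, fun y hy => ?_⟩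
  have h1 : (G.edist y x : ENNReal) < 1 := hy
  have h2 : G.edist y x < 1 := by exact_mod_cast h1
  rw [Order.lt_one_iff, edist_eq_zero_iff] at h2
  rwa [h2]

/-- The graph has asymptotic dimension at most `n` if at every scale `k` it has a uniformly bounded
cover of multiplicity at most `n + 1` of which every `k`-ball lies in a member. -/
lemma asdimLE_of_forall_exists_cover [Nonempty V] {n : ℕ}
    (h : ∀ k : ℕ, 0 < k → ∃ (𝒰 : Set (Set V)) (D : ℕ), (∀ x, ∃ U ∈ 𝒰, ∀ y, G.Within k x y → y ∈ U) ∧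
      (∀ U ∈ 𝒰, ∀ x ∈ U, ∀ y ∈ U, G.Within D x y) ∧ MultiplicityLE 𝒰 (n + 1)) :
    letI := graphMetric G; AsdimLE V n := by
  let := graphMetric G
  intro 𝒱 hcov hbdd
  obtain ⟨K, hK⟩ := ENNReal.exists_nat_gt hbdd.ne
  -- The bound `K` may be zero, while covers are given at positive scales only.
  obtain ⟨𝒰, D, hleb, hD, hmult⟩ := h (K + 1) (by omega)
  refine ⟨𝒰, ⟨fun A _ => isOpen_graphMetric A, ?_⟩, ?_, hmult, ?_⟩
  · refine Set.eq_univ_of_forall fun x => ?_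
    obtain ⟨U, hU, hx⟩ := hleb x
    exact ⟨U, hU, hx x (Within.refl G _ x)⟩
  · refine lt_of_le_of_lt (b := (D : ENNReal)) (iSup₂_le fun U hU => ?_) (by simp)
    exact Metric.ediam_le fun x hx y hy => (graphMetric_edist_le_iff D x y).2 (hD U hU x hx y hy)
  · intro A hA
    rcases A.eq_empty_or_nonempty with rfl | ⟨x, hx⟩
    · obtain ⟨U, hU, -⟩ := hleb (Classical.arbitrary V)
      exact ⟨U, hU, Set.empty_subset U⟩
    · obtain ⟨U, hU, hxU⟩ := hleb x
      refine ⟨U, hU, fun y hy => hxU y (Within.mono (r := K) ?_ (by omega))⟩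
      rw [← graphMetric_edist_le_iff]
      refine (Metric.edist_le_ediam_of_mem hx hy).trans (le_trans ?_ hK.le)
      exact le_iSup₂ (f := fun A (_ : A ∈ 𝒱) => Metric.ediam A) A hA

end SimpleGraph

/-! ### Gluing covers of pieces along lower dimensional boundaries -/

/-- A set is small if its elements can be labelled injectively by a small finite set. -/
lemma Set.encard_le_of_label {α β : Type*} {S : Set α} (F : Finset β) (lab : α → β → Prop)
    (hex : ∀ s ∈ S, ∃ b ∈ F, lab s b)
    (hinj : ∀ s ∈ S, ∀ s' ∈ S, ∀ b, lab s b → lab s' b → s = s') : S.encard ≤ F.card := by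
  rcases S.eq_empty_or_nonempty with rfl | ⟨s₀, hs₀⟩
  · simp
  have : Nonempty β := ⟨(hex s₀ hs₀).choose⟩
  choose! f hf hlab using hex
  rw [← Set.encard_coe_eq_coe_finsetCard F]
  exact Set.encard_le_encard_of_injOn (f := f) (fun s hs => hf s hs)
    fun s hs s' hs' h => hinj s hs s' hs' (f s) (hlab s hs) (h ▸ hlab s' hs')

namespace SimpleGraph

variable {V : Type*} {G : SimpleGraph V}

/-- Suppose that a graph is partitioned into pieces, and that `h` measures the distance from the
boundary of the pieces. If a neighbourhood of the boundary can be coloured with `n` colours, and the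
pieces with `n + 1` colours at every scale, then the graph has a uniformly bounded cover of
multiplicity at most `n + 1` of which every `k`-ball lies in a member. -/
theorem exists_cover_of_partition [Nonempty V] {ι : Type*} {n k d : ℕ} (hk : 0 < k) (p : V → ι) (h : V → ℕ)
    (hh : ∀ x y, G.Within k x y → h x ≤ h y + k)
    (hp : ∀ x y, G.Within k x y → p x ≠ p y → h x ≤ k)
    (hbd : G.HasColoring {x | h x ≤ 3 * k * (n + 1) + k} n (2 * k) d)
    (hpiece : ∀ r, ∃ D, ∀ i, G.HasColoring (p ⁻¹' {i}) (n + 1) r D) :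
    ∃ (𝒰 : Set (Set V)) (D : ℕ), (∀ x, ∃ U ∈ 𝒰, ∀ y, G.Within k x y → y ∈ U) ∧
      (∀ U ∈ 𝒰, ∀ x ∈ U, ∀ y ∈ U, G.Within D x y) ∧ MultiplicityLE 𝒰 (n + 1) := by
  classical
  obtain ⟨c, hc, hcb⟩ := hbd
  -- Two vertices of a piece within `k + d` of a common point are then `2 * (k + d)`-close, so if
  -- they have the same colour they lie in one component. The `d` allows for the size of a boundary
  -- component.
  obtain ⟨D, hD⟩ := hpiece (2 * (k + d))
  choose e he heb using hD
  set Z : Set V := {x | h x ≤ 3 * k * (n + 1) + k} with hZ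
  -- `ZC` and `PC` join vertices in the same component of the boundary or of a piece
  let ZC : V → V → Prop := G.Chain Z c (2 * k)
  let PC : ι → V → V → Prop := fun i => G.Chain (p ⁻¹' {i}) (e i) (2 * (k + d))
  have ZCs : ∀ {a b}, ZC a b → ZC b a := fun hab => Chain.symm hab
  have PCs : ∀ {i a b}, PC i a b → PC i b a := fun hab => Chain.symm hab
  -- Boundary components of colour `j` are cut off at height `thr j`. The spacing `3 * k` exceeds
  -- the overlap `2 * k` with the piece sets.
  let thr : ℕ → ℕ := fun j => 3 * k * (j + 1)
  have hthr : ∀ {a b}, a < b → thr a + 3 * k ≤ thr b := fun {a b} hab => by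
    calc thr a + 3 * k = 3 * k * (a + 1 + 1) := by simp only [thr]; ring
      _ ≤ thr b := Nat.mul_le_mul_left _ (by omega)
  have hthr0 : ∀ j, 3 * k ≤ thr j := fun j => Nat.le_mul_of_pos_right _ (by omega)
  -- Each boundary component selects one of its vertices in each piece it meets. Near it, only the
  -- piece component of that vertex is used, so that a boundary colour contributes a single piece
  -- set at each low point.
  let rep : V → ι → V := fun v i => Classical.epsilon fun v' => ZC v v' ∧ p v' = i
  have rep_spec : ∀ v v' i, ZC v v' → p v' = i → ZC v (rep v i) ∧ p (rep v i) = i :=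
    fun v v' i h1 h2 => Classical.epsilon_spec (p := fun v' => ZC v v' ∧ p v' = i) ⟨v', h1, h2⟩
  have rep_congr : ∀ {v v'} i, ZC v v' → rep v i = rep v' i := fun {v v'} i hv => by
    have : (fun w => ZC v w ∧ p w = i) = fun w => ZC v' w ∧ p w = i := by
      funext w
      exact propext (and_congr_left fun _ => ⟨fun hw => (ZCs hv).trans hw, fun hw => hv.trans hw⟩)
    simp only [rep, this]
  let bdSet : V → Set V := fun v => {y | h y ≤ thr (c v) ∧ ∃ v', ZC v v' ∧ G.Within k y v'}
  let pcSet : V → Set V := fun u => {y | p y = p u ∧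
    (∃ u', PC (p u) u u' ∧ G.Within (k + d) y u') ∧
    (thr n ≤ h y ∨ ∃ v ∈ Z, G.Within k y v ∧ thr (c v) ≤ h y + 2 * k ∧
      PC (p u) u (rep v (p u)))}
  have bdSet_congr : ∀ {v v'}, ZC v v' → bdSet v = bdSet v' := fun {v v'} hv => by
    have hcv : c v = c v' := Chain.color_eq hv
    ext y
    simp only [bdSet, Set.mem_ofPred_eq, hcv]
    refine and_congr_right fun _ => exists_congr fun w => and_congr_left fun _ => ?_
    exact ⟨fun hw => (ZCs hv).trans hw, fun hw => hv.trans hw⟩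
  have pcSet_congr : ∀ {u u'}, PC (p u) u u' → pcSet u = pcSet u' := fun {u u'} hu => by
    have hpu : p u' = p u := (Chain.mem_iff hu).1 rfl
    have hiff : ∀ w, PC (p u) u w ↔ PC (p u) u' w := fun w =>
      ⟨fun hw => (PCs hu).trans hw, fun hw => hu.trans hw⟩
    ext y
    simp only [pcSet, Set.mem_ofPred_eq, hpu, hiff]
  have ZC_of_near : ∀ {x v v'}, v ∈ Z → v' ∈ Z → c v = c v' → G.Within k x v → G.Within k x v' →
      ZC v v' := fun hv hv' hcv hxv hxv' =>
    Relation.ReflTransGen.single ⟨hv, hv', hcv, hxv.symm.trans hxv' (by omega)⟩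
  refine ⟨bdSet '' Z ∪ Set.range pcSet, D + 2 * (k + d), fun x => ?_, ?_, fun x => ?_⟩
  -- A ball deep in a piece lies in the piece set of its centre. Any other lies in the boundary set
  -- of its centre or, where that is cut off, in the piece set assigned to this boundary component.
  · by_cases hx : thr n + k < h x
    · refine ⟨pcSet x, Or.inr ⟨x, rfl⟩, fun y hy => ⟨?_, ⟨x, .refl, hy.symm.mono (by omega)⟩, ?_⟩⟩
      · by_contra hne
        have := hp x y hy (Ne.symm hne)
        omega
      · have := hh x y hy
        left; omega
    · have hxZ : x ∈ Z := not_lt.1 hx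
      by_cases hxc : h x + k ≤ thr (c x)
      · refine ⟨bdSet x, Or.inl ⟨x, hxZ, rfl⟩, fun y hy => ⟨?_, x, .refl, hy.symm⟩⟩
        exact (hh y x hy.symm).trans hxc
      · obtain ⟨h1, h2⟩ := rep_spec x x (p x) .refl rfl
        refine ⟨pcSet (rep x (p x)), Or.inr ⟨_, rfl⟩, fun y hy => ⟨?_, ⟨_, .refl, ?_⟩, Or.inr
          ⟨x, hxZ, hy.symm, ?_, ?_⟩⟩⟩
        · rw [h2]
          by_contra hne
          have h3 := hp x y hy (Ne.symm hne)
          have h4 := hthr0 (c x)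
          omega
        · exact hy.symm.trans (hcb _ _ h1) le_rfl
        · have := hh x y hy
          omega
        · rw [h2]
  · rintro _ (⟨v, hv, rfl⟩ | ⟨u, rfl⟩) x hx y hy
    · obtain ⟨-, v₁, hv₁, hx⟩ := hx
      obtain ⟨-, v₂, hv₂, hy⟩ := hy
      exact (hx.trans (hcb _ _ ((ZCs hv₁).trans hv₂)) le_rfl).trans hy.symm (by omega)
    · obtain ⟨-, ⟨u₁, hu₁, hx⟩, -⟩ := hx
      obtain ⟨-, ⟨u₂, hu₂, hy⟩, -⟩ := hy
      exact (hx.trans (heb _ _ _ ((PCs hu₁).trans hu₂)) le_rfl).trans hy.symm (by omega)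
  -- From height `thr n` on, only piece sets occur, at most one for each of the `n + 1` colours of
  -- the piece.
  by_cases hx : thr n ≤ h x
  · have key := Set.encard_le_of_label (S := {A | A ∈ bdSet '' Z ∪ Set.range pcSet ∧ x ∈ A})
      (Finset.range (n + 1)) (fun A b => ∃ u, A = pcSet u ∧ p x = p u ∧ e (p x) u = b ∧
        ∃ u', PC (p u) u u' ∧ G.Within (k + d) x u') ?_ ?_
    · simpa using key
    · rintro _ ⟨⟨v, hv, rfl⟩ | ⟨u, rfl⟩, hxA⟩
      · have h1 := hthr (hc v hv)
        have h2 := hxA.1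
        omega
      · refine ⟨e (p x) u, Finset.mem_range.2 (he _ _ ?_), u, rfl, hxA.1, rfl, hxA.2.1⟩
        exact hxA.1.symm
    · rintro _ - _ - b ⟨u₁, rfl, hp₁, he₁, w₁, hw₁, hx₁⟩ ⟨u₂, rfl, hp₂, he₂, w₂, hw₂, hx₂⟩
      rw [← hp₁] at hw₁
      rw [← hp₂] at hw₂
      have hm₁ : w₁ ∈ p ⁻¹' {p x} := (Chain.mem_iff hw₁).1 hp₁.symm
      have hm₂ : w₂ ∈ p ⁻¹' {p x} := (Chain.mem_iff hw₂).1 hp₂.symm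
      have hcol : e (p x) w₁ = e (p x) w₂ := by
        rw [← Chain.color_eq hw₁, ← Chain.color_eq hw₂, he₁, he₂]
      refine pcSet_congr ?_
      rw [← hp₁]
      exact (hw₁.tail ⟨hm₁, hm₂, hcol, hx₁.symm.trans hx₂ (by omega)⟩).trans (PCs hw₂)
  -- Below `thr n`, each colour in `F₁` gives at most one boundary set and each colour in `F₂` at
  -- most one piece set. A colour in both has its threshold in an interval of length `2 * k`, so
  -- there is at most one.
  · set F₁ := (Finset.range n).filter fun j => h x ≤ thr j with hF₁
    set F₂ := (Finset.range n).filter fun j => thr j ≤ h x + 2 * k with hF₂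
    have hcard : (F₁.disjSum F₂).card ≤ n + 1 := by
      rw [Finset.card_disjSum, ← Finset.card_union_add_card_inter]
      refine add_le_add ?_ ?_
      · calc (F₁ ∪ F₂).card ≤ (Finset.range n).card :=
            Finset.card_le_card (Finset.union_subset (Finset.filter_subset _ _)
              (Finset.filter_subset _ _))
          _ = n := Finset.card_range n
      · refine Finset.card_le_one.2 fun a ha b hb => ?_
        simp only [hF₁, hF₂, Finset.mem_inter, Finset.mem_filter] at ha hb
        by_contra hne
        rcases lt_or_gt_of_ne hne with hab | hab
        · have := hthr hab; omega
        · have := hthr hab; omega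
    refine le_trans (Set.encard_le_of_label (F₁.disjSum F₂) (fun A b => Sum.elim
      (fun j => ∃ v ∈ Z, A = bdSet v ∧ c v = j ∧ ∃ v', ZC v v' ∧ G.Within k x v')
      (fun j => ∃ u, ∃ v ∈ Z, A = pcSet u ∧ p x = p u ∧ c v = j ∧ G.Within k x v ∧
        PC (p u) u (rep v (p u))) b) ?_ ?_) (by exact_mod_cast hcard)
    · rintro _ ⟨⟨v, hv, rfl⟩ | ⟨u, rfl⟩, hxA⟩
      · refine ⟨Sum.inl (c v), Finset.inl_mem_disjSum.2 (Finset.mem_filter.2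
          ⟨Finset.mem_range.2 (hc v hv), hxA.1⟩), v, hv, rfl, rfl, hxA.2⟩
      · obtain ⟨hpx, -, h1⟩ := hxA
        obtain ⟨v, hv, hxv, hcv, hPC⟩ := h1.resolve_left hx
        exact ⟨Sum.inr (c v), Finset.inr_mem_disjSum.2 (Finset.mem_filter.2
          ⟨Finset.mem_range.2 (hc v hv), hcv⟩), u, v, hv, rfl, hpx, rfl, hxv, hPC⟩
    · rintro _ - _ - (j | j)
      · rintro ⟨v, hv, rfl, hcv, w, hw, hxw⟩ ⟨v', hv', rfl, hcv', w', hw', hxw'⟩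
        refine bdSet_congr (hw.trans ((ZC_of_near ?_ ?_ ?_ hxw hxw').trans (ZCs hw')))
        · exact (Chain.mem_iff hw).1 hv
        · exact (Chain.mem_iff hw').1 hv'
        · rw [← Chain.color_eq hw, ← Chain.color_eq hw', hcv, hcv']
      · rintro ⟨u, v, hv, rfl, hpu, hcv, hxv, hPC⟩ ⟨u', v', hv', rfl, hpu', hcv', hxv', hPC'⟩
        have hvv' := ZC_of_near hv hv' (hcv.trans hcv'.symm) hxv hxv'
        rw [← hpu', ← rep_congr _ hvv'] at hPC'
        refine pcSet_congr (hPC.trans ?_)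
        rw [← hpu]
        exact PCs hPC'

end SimpleGraph

/-! ### Rooted trees of graphs -/

/-- A graph `copy` whose vertices are distributed over the nodes of a rooted forest such that edges
lie within nodes, and a graph `bond` that matches, for every node, some of its vertices with some
vertices of its parent. The components of `bond` meet at most `size` nodes. -/
structure RootedTreeOfGraphs (P T : Type*) where
  /-- the edges within the nodes -/
  copy : SimpleGraph P
  /-- the edges between the nodes -/
  bond : SimpleGraph P
  /-- the node of a vertex -/
  node : P → T
  /-- the distance from the root -/
  depth : T → ℕ
  /-- the parent of a node -/
  parent : T → T
  depth_parent : ∀ t, depth (parent t) = depth t - 1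
  copy_adj : ∀ p q, copy.Adj p q → node p = node q
  bond_adj : ∀ p q, bond.Adj p q → (node q = parent (node p) ∧ depth (node p) = depth (node q) + 1) ∨
    (node p = parent (node q) ∧ depth (node q) = depth (node p) + 1)
  bond_unique : ∀ p q q', bond.Adj p q → bond.Adj p q' → node q = node q' → q = q'
  /-- the maximal number of nodes that a component of `bond` meets -/
  size : ℕ
  encard_le : ∀ a : bond.ConnectedComponent,
    {t | ∃ x, node x = t ∧ bond.connectedComponentMk x = a}.encard ≤ size

namespace RootedTreeOfGraphs

open SimpleGraph

variable {P T : Type*} (𝒯 : RootedTreeOfGraphs P T)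

/-- The vertices of the contracted graph. -/
abbrev Vtx : Type _ := 𝒯.bond.ConnectedComponent

/-- The contraction map. -/
abbrev cls (p : P) : 𝒯.Vtx := 𝒯.bond.connectedComponentMk p

/-- The graph obtained by contracting all bonds. -/
def contraction : SimpleGraph 𝒯.Vtx where
  Adj a b := a ≠ b ∧ ∃ x y, 𝒯.cls x = a ∧ 𝒯.cls y = b ∧ (𝒯.copy ⊔ 𝒯.bond).Adj x y
  symm := ⟨fun _ _ ⟨hne, x, y, hx, hy, h⟩ => ⟨hne.symm, y, x, hy, hx, h.symm⟩⟩
  loopless := ⟨fun _ h => h.1 rfl⟩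

lemma exists_copy_adj {a b : 𝒯.Vtx} (h : 𝒯.contraction.Adj a b) :
    ∃ x y, 𝒯.cls x = a ∧ 𝒯.cls y = b ∧ 𝒯.copy.Adj x y := by
  obtain ⟨hne, x, y, rfl, rfl, h | h⟩ := h
  · exact ⟨x, y, rfl, rfl, h⟩
  · exact absurd (ConnectedComponent.sound h.reachable) hne

lemma cls_within {r : ℕ} {p q : P} (h : 𝒯.copy.Within r p q) :
    𝒯.contraction.Within r (𝒯.cls p) (𝒯.cls q) := by
  obtain ⟨w, hw⟩ := h.exists_walk
  induction w generalizing r with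
  | nil => exact Within.refl _ _ _
  | @cons u v _ hadj w ih =>
    rw [Walk.length_cons] at hw
    have h1 := ih (w.within le_rfl) le_rfl
    by_cases huv : 𝒯.cls u = 𝒯.cls v
    · rw [huv]; exact h1.mono (by omega)
    · have : 𝒯.contraction.Adj (𝒯.cls u) (𝒯.cls v) := ⟨huv, u, v, rfl, rfl, Or.inl hadj⟩
      exact this.within.trans h1 (by omega)

/-! #### Ancestors -/

/-- The ancestor of `t` at depth `d`. -/
def anc (d : ℕ) (t : T) : T := 𝒯.parent^[𝒯.depth t - d] t

/-- The node `s` is `t` or a descendant of `t`. -/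
def Below (t s : T) : Prop := 𝒯.depth t ≤ 𝒯.depth s ∧ 𝒯.anc (𝒯.depth t) s = t

variable {𝒯}

lemma anc_parent {d : ℕ} {t : T} (h : d < 𝒯.depth t) : 𝒯.anc d (𝒯.parent t) = 𝒯.anc d t := by
  unfold anc
  rw [𝒯.depth_parent, ← Function.iterate_succ_apply]
  congr 2
  omega

lemma anc_depth (t : T) : 𝒯.anc (𝒯.depth t) t = t := by simp [anc]

lemma anc_eq_self {d : ℕ} {t : T} (h : 𝒯.depth t = d) : 𝒯.anc d t = t := by
  rw [← h, anc_depth]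

lemma depth_anc {d : ℕ} {t : T} (h : d ≤ 𝒯.depth t) : 𝒯.depth (𝒯.anc d t) = d := by
  have key : ∀ i, 𝒯.depth (𝒯.parent^[i] t) = 𝒯.depth t - i := by
    intro i
    induction i with
    | zero => rfl
    | succ i ih => rw [Function.iterate_succ_apply', 𝒯.depth_parent, ih]; omega
  rw [anc, key]
  omega

lemma Below.refl (t : T) : 𝒯.Below t t := ⟨le_rfl, anc_depth t⟩

lemma Below.eq {t s : T} (h : 𝒯.Below t s) (hd : 𝒯.depth s ≤ 𝒯.depth t) : s = t :=
  (anc_eq_self (le_antisymm hd h.1)).symm.trans h.2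

lemma Below.parent {t s : T} (h : 𝒯.Below t s) (hd : 𝒯.depth t < 𝒯.depth s) :
    𝒯.Below t (𝒯.parent s) :=
  ⟨by rw [𝒯.depth_parent]; omega, by rw [anc_parent hd, h.2]⟩

lemma Below.of_parent {t s : T} (h : 𝒯.Below t (𝒯.parent s)) (hd : 𝒯.depth t < 𝒯.depth s) :
    𝒯.Below t s :=
  ⟨hd.le, by rw [← anc_parent hd, h.2]⟩

lemma below_anc {d : ℕ} {t : T} (h : d ≤ 𝒯.depth t) : 𝒯.Below (𝒯.anc d t) t := by
  refine ⟨by rwa [depth_anc h], by rw [depth_anc h]⟩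

/-- A bond leads to the parent or to a child, so the subtree below `t` can be left only upwards from
`t` itself. -/
lemma eq_of_bond_of_below {t : T} {a b : P} (h : 𝒯.bond.Adj a b) (ha : 𝒯.Below t (𝒯.node a))
    (hb : ¬𝒯.Below t (𝒯.node b)) : 𝒯.node a = t ∧ 𝒯.node b = 𝒯.parent t := by
  rcases 𝒯.bond_adj a b h with ⟨h1, h2⟩ | ⟨h1, h2⟩
  · rcases ha.1.lt_or_eq with hlt | heq
    · exact absurd (h1 ▸ ha.parent hlt) hb
    · have := ha.eq heq.ge
      exact ⟨this, by rw [h1, this]⟩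
  · have hlt := ha.1
    exact absurd (Below.of_parent (h1 ▸ ha) (by omega)) hb

/-! #### The vertex of a contracted set that is closest to the root -/

variable (𝒯) in
open Classical in
/-- The neighbour of `p` in the parent of its node, or `p` if there is none. -/
noncomputable def up (p : P) : P :=
  if h : ∃ q, 𝒯.bond.Adj p q ∧ 𝒯.depth (𝒯.node q) < 𝒯.depth (𝒯.node p) then h.choose else p

variable (𝒯) in
/-- The vertex closest to the root that is identified with `p`. -/
noncomputable def top (p : P) : P := 𝒯.up^[𝒯.depth (𝒯.node p)] p

lemma up_spec {p : P} (h : 𝒯.up p ≠ p) : 𝒯.bond.Adj p (𝒯.up p) ∧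
    𝒯.node (𝒯.up p) = 𝒯.parent (𝒯.node p) ∧
    𝒯.depth (𝒯.node p) = 𝒯.depth (𝒯.node (𝒯.up p)) + 1 := by
  by_cases hex : ∃ q, 𝒯.bond.Adj p q ∧ 𝒯.depth (𝒯.node q) < 𝒯.depth (𝒯.node p)
  · have hup : 𝒯.up p = hex.choose := dif_pos hex
    obtain ⟨h1, h2⟩ := hex.choose_spec
    rw [← hup] at h1 h2
    rcases 𝒯.bond_adj _ _ h1 with h3 | h3
    · exact ⟨h1, h3⟩
    · omega
  · exact absurd (dif_neg hex) h

lemma up_eq {p q : P} (h : 𝒯.bond.Adj p q) (hd : 𝒯.depth (𝒯.node q) < 𝒯.depth (𝒯.node p)) :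
    𝒯.up p = q := by
  have hex : ∃ q, 𝒯.bond.Adj p q ∧ 𝒯.depth (𝒯.node q) < 𝒯.depth (𝒯.node p) := ⟨q, h, hd⟩
  have hup : 𝒯.up p = hex.choose := dif_pos hex
  obtain ⟨h1, h2⟩ := hex.choose_spec
  rw [hup]
  refine 𝒯.bond_unique p _ _ h1 h ?_
  rcases 𝒯.bond_adj _ _ h1 with h3 | h3
  · rcases 𝒯.bond_adj _ _ h with h4 | h4
    · rw [h3.1, h4.1]
    · omega
  · omega

lemma up_induction {motive : P → Prop} (base : ∀ p, 𝒯.up p = p → motive p)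
    (step : ∀ p, 𝒯.up p ≠ p → motive (𝒯.up p) → motive p) (p : P) : motive p := by
  induction hd : 𝒯.depth (𝒯.node p) generalizing p with
  | zero =>
    by_cases h : 𝒯.up p = p
    · exact base p h
    · have := (up_spec h).2.2
      omega
  | succ d ih =>
    by_cases h : 𝒯.up p = p
    · exact base p h
    · have := (up_spec h).2.2
      exact step p h (ih _ (by omega))

lemma top_eq_self {p : P} (h : 𝒯.up p = p) : 𝒯.top p = p := Function.iterate_fixed h _

lemma top_up (p : P) : 𝒯.top (𝒯.up p) = 𝒯.top p := by
  by_cases h : 𝒯.up p = p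
  · rw [h]
  · rw [top, top, (up_spec h).2.2, Function.iterate_succ_apply]

lemma cls_up (p : P) : 𝒯.cls (𝒯.up p) = 𝒯.cls p := by
  by_cases h : 𝒯.up p = p
  · rw [h]
  · exact (ConnectedComponent.sound (up_spec h).1.reachable).symm

lemma cls_top (p : P) : 𝒯.cls (𝒯.top p) = 𝒯.cls p := by
  induction p using up_induction (𝒯 := 𝒯) with
  | base p h => rw [top_eq_self h]
  | step p h ih => rw [← top_up, ih, cls_up]

/-- Of the two ends of a bond, one is the `up` of the other, and `top` is invariant under `up`. -/
lemma top_eq_of_cls_eq {p q : P} (h : 𝒯.cls p = 𝒯.cls q) : 𝒯.top p = 𝒯.top q := by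
  obtain ⟨w⟩ := ConnectedComponent.exact h
  induction w with
  | nil => rfl
  | cons hadj w ih =>
    rw [← ih (ConnectedComponent.sound w.reachable)]
    rcases 𝒯.bond_adj _ _ hadj with h1 | h1
    · rw [← up_eq hadj (by omega), top_up]
    · rw [← up_eq hadj.symm (by omega), top_up]

variable (𝒯) in
/-- The node closest to the root among those that contain a preimage of `a`. -/
noncomputable def topNode (a : 𝒯.Vtx) : T := 𝒯.node (𝒯.top (Quot.out a))

variable (𝒯) in
/-- The depth of the top node. -/
noncomputable def topDepth (a : 𝒯.Vtx) : ℕ := 𝒯.depth (𝒯.topNode a)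

lemma topNode_cls (p : P) : 𝒯.topNode (𝒯.cls p) = 𝒯.node (𝒯.top p) := by
  rw [topNode, top_eq_of_cls_eq (q := p)]
  exact Quot.out_eq (𝒯.cls p)

lemma topDepth_cls (p : P) : 𝒯.topDepth (𝒯.cls p) = 𝒯.depth (𝒯.node (𝒯.top p)) := by
  rw [topDepth, topNode_cls]

lemma exists_cls_eq_topNode (a : 𝒯.Vtx) : ∃ p, 𝒯.cls p = a ∧ 𝒯.node p = 𝒯.topNode a :=
  ⟨𝒯.top (Quot.out a), (cls_top _).trans (Quot.out_eq a), rfl⟩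

lemma depth_top_le (p : P) : 𝒯.depth (𝒯.node (𝒯.top p)) ≤ 𝒯.depth (𝒯.node p) := by
  induction p using up_induction (𝒯 := 𝒯) with
  | base p h => rw [top_eq_self h]
  | step p h ih =>
    have := (up_spec h).2.2
    rw [top_up] at ih
    omega

lemma topDepth_le (p : P) : 𝒯.topDepth (𝒯.cls p) ≤ 𝒯.depth (𝒯.node p) := by
  rw [topDepth_cls]; exact depth_top_le p

/-- On the way from `p` to its top, the class meets a node at every intermediate depth, and it meets
at most `size` nodes. -/
lemma depth_le_topDepth_add (p : P) :
    𝒯.depth (𝒯.node p) ≤ 𝒯.topDepth (𝒯.cls p) + 𝒯.size := by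
  have key : ∀ p, Set.Icc (𝒯.topDepth (𝒯.cls p)) (𝒯.depth (𝒯.node p)) ⊆
      𝒯.depth '' {t | ∃ x, 𝒯.node x = t ∧ 𝒯.cls x = 𝒯.cls p} := by
    intro p
    induction p using up_induction (𝒯 := 𝒯) with
    | base p h =>
      rw [topDepth_cls, top_eq_self h, Set.Icc_self, Set.singleton_subset_iff]
      exact ⟨_, ⟨p, rfl, rfl⟩, rfl⟩
    | step p h ih =>
      rw [cls_up] at ih
      intro d hd
      rcases hd.2.eq_or_lt with rfl | hlt
      · exact ⟨_, ⟨p, rfl, rfl⟩, rfl⟩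
      · have := (up_spec h).2.2
        exact ih ⟨hd.1, by omega⟩
  have h1 := ((Set.encard_le_encard (key p)).trans (Set.encard_image_le _ _)).trans
    (𝒯.encard_le (𝒯.cls p))
  rw [← Finset.coe_Icc, Set.encard_coe_eq_coe_finsetCard, Nat.card_Icc] at h1
  have h2 : 𝒯.depth (𝒯.node p) + 1 - 𝒯.topDepth (𝒯.cls p) ≤ 𝒯.size := by exact_mod_cast h1
  omega

lemma bond_within_top (p : P) : 𝒯.bond.Within 𝒯.size p (𝒯.top p) := by
  have key : ∀ p, 𝒯.bond.Within (𝒯.depth (𝒯.node p) - 𝒯.topDepth (𝒯.cls p)) p (𝒯.top p) := by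
    intro p
    induction p using up_induction (𝒯 := 𝒯) with
    | base p h => rw [top_eq_self h]; exact Within.refl _ _ _
    | step p h ih =>
      have h1 := (up_spec h).2.2
      have h2 := topDepth_le (𝒯 := 𝒯) (𝒯.up p)
      rw [top_up, cls_up] at *
      exact (up_spec h).1.within.trans ih (by omega)
  have := depth_le_topDepth_add (𝒯 := 𝒯) p
  exact (key p).mono (by omega)

lemma anc_node {d : ℕ} {p : P} (h : d ≤ 𝒯.topDepth (𝒯.cls p)) :
    𝒯.anc d (𝒯.node p) = 𝒯.anc d (𝒯.topNode (𝒯.cls p)) := by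
  induction p using up_induction (𝒯 := 𝒯) with
  | base p hp => rw [topNode_cls, top_eq_self hp]
  | step p hp ih =>
    rw [cls_up] at ih
    have h1 := up_spec hp
    have h2 := topDepth_le (𝒯 := 𝒯) (𝒯.up p)
    rw [cls_up] at h2
    rw [← ih h, h1.2.1, anc_parent (by omega)]

lemma exists_up_ne {d : ℕ} {p : P} (h : 𝒯.topDepth (𝒯.cls p) < d) (hd : d ≤ 𝒯.depth (𝒯.node p)) :
    ∃ q, 𝒯.cls q = 𝒯.cls p ∧ 𝒯.node q = 𝒯.anc d (𝒯.node p) ∧ 𝒯.up q ≠ q := by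
  induction p using up_induction (𝒯 := 𝒯) with
  | base p hp => rw [topDepth_cls, top_eq_self hp] at h; omega
  | step p hp ih =>
    rcases hd.eq_or_lt with heq | hlt
    · exact ⟨p, rfl, (anc_eq_self heq.symm).symm, hp⟩
    · have h1 := up_spec hp
      obtain ⟨q, hq, hqn, hqu⟩ := ih (by rwa [cls_up]) (by omega)
      exact ⟨q, hq.trans (cls_up p), by rw [hqn, h1.2.1, anc_parent hlt], hqu⟩

/-- The edge lifts into a single node, where both classes have preimages. -/
lemma topDepth_le_of_adj {a b : 𝒯.Vtx} (h : 𝒯.contraction.Adj a b) :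
    𝒯.topDepth a ≤ 𝒯.topDepth b + 𝒯.size := by
  obtain ⟨x, y, rfl, rfl, hxy⟩ := 𝒯.exists_copy_adj h
  refine (topDepth_le x).trans ?_
  rw [𝒯.copy_adj x y hxy]
  exact depth_le_topDepth_add y

/-- Leaving the part of the contracted graph below a node is only possible through the vertices that
this node shares with its parent. -/
lemma anc_eq_or_exists_near {d i : ℕ} {a b : 𝒯.Vtx} (hab : 𝒯.contraction.Within i a b)
    (ha : d ≤ 𝒯.topDepth a) :
    (d ≤ 𝒯.topDepth b ∧ 𝒯.anc d (𝒯.topNode b) = 𝒯.anc d (𝒯.topNode a)) ∨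
    ∃ q, 𝒯.node q = 𝒯.anc d (𝒯.topNode a) ∧ 𝒯.up q ≠ q ∧ 𝒯.topDepth (𝒯.cls q) < d ∧
      𝒯.contraction.Within i a (𝒯.cls q) := by
  obtain ⟨w, hw⟩ := hab.exists_walk
  clear hab
  induction w generalizing i with
  | nil => exact Or.inl ⟨ha, rfl⟩
  | @cons a v b hadj w ih =>
    rw [Walk.length_cons] at hw
    obtain ⟨x, y, rfl, rfl, hxy⟩ := 𝒯.exists_copy_adj hadj
    have hn := 𝒯.copy_adj x y hxy
    by_cases hv : d ≤ 𝒯.topDepth (𝒯.cls y)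
    · have hanc : 𝒯.anc d (𝒯.topNode (𝒯.cls y)) = 𝒯.anc d (𝒯.topNode (𝒯.cls x)) := by
        rw [← anc_node ha, ← anc_node hv, hn]
      rcases ih hv (i := i - 1) (by omega) with ⟨h1, h2⟩ | ⟨q, h1, h2, h3, h4⟩
      · exact Or.inl ⟨h1, h2.trans hanc⟩
      · exact Or.inr ⟨q, h1.trans hanc, h2, h3, hadj.within.trans h4 (by omega)⟩
    -- The class of `y` still meets the node of `x` but has top depth less than `d`, so on its way
    -- up it passes from the ancestor at depth `d` to the parent of that node.
    · obtain ⟨q, h1, h2, h3⟩ := exists_up_ne (p := y) (not_le.1 hv)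
        (hn ▸ ha.trans (topDepth_le x))
      refine Or.inr ⟨q, ?_, h3, by rw [h1]; omega, by rw [h1]; exact hadj.within.mono (by omega)⟩
      rw [h2, ← hn, anc_node ha]

/-! #### The nodes are coarsely embedded -/

variable (𝒯) in
/-- The bonds between any two nodes form a coarse equivalence, uniformly. -/
def CoarseBonds : Prop :=
  ∀ r, ∃ K, ∀ p p' q q', 𝒯.bond.Adj p p' → 𝒯.bond.Adj q q' → 𝒯.node p = 𝒯.node q →
    𝒯.node p' = 𝒯.node q' → 𝒯.copy.Within r p q → 𝒯.copy.Within K p' q'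

lemma sup_within_of_cls_eq {p q : P} (h : 𝒯.cls p = 𝒯.cls q) :
    (𝒯.copy ⊔ 𝒯.bond).Within (2 * 𝒯.size) p q := by
  have h1 : 𝒯.bond.Within (2 * 𝒯.size) p q :=
    (bond_within_top p).trans (top_eq_of_cls_eq h ▸ (bond_within_top q).symm) (by omega)
  exact h1.map id fun a b hab => Or.inr hab

/-- Each edge lifts to a copy edge. Before each lift and after the last one, at most `2 * size`
bonds are needed: `size` up to the top of a class and `size` down again. -/
lemma sup_within_of_cls_within {r : ℕ} {p q : P} (h : 𝒯.contraction.Within r (𝒯.cls p) (𝒯.cls q)) :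
    (𝒯.copy ⊔ 𝒯.bond).Within ((2 * 𝒯.size + 1) * r + 2 * 𝒯.size) p q := by
  obtain ⟨w, hw⟩ := h.exists_walk
  have key : ∀ {a b : 𝒯.Vtx} (w : 𝒯.contraction.Walk a b) (p q : P), 𝒯.cls p = a → 𝒯.cls q = b →
      (𝒯.copy ⊔ 𝒯.bond).Within ((2 * 𝒯.size + 1) * w.length + 2 * 𝒯.size) p q := by
    intro a b w
    induction w with
    | nil =>
      intro p q hp hq
      exact (sup_within_of_cls_eq (hp.trans hq.symm)).mono (by omega)
    | cons hadj w ih =>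
      intro p q hp hq
      obtain ⟨x, y, hx, hy, hxy⟩ := 𝒯.exists_copy_adj hadj
      have hxy' : (𝒯.copy ⊔ 𝒯.bond).Adj x y := Or.inl hxy
      refine ((sup_within_of_cls_eq (hp.trans hx.symm)).trans hxy'.within le_rfl).trans
        (ih y q hy hq) ?_
      rw [Walk.length_cons, mul_add]
      omega
  exact (key w p q rfl rfl).mono (by gcongr)

/-- Induction on the length. If the walk leaves its node over a bond, it returns over a bond of the
same tree edge. The part in between has both ends in one node, so it is bounded by `K`, and
`CoarseBonds` carries this back as `K'`. -/
lemma CoarseBonds.exists_copy_within_of_walk (h : 𝒯.CoarseBonds) (L : ℕ) :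
    ∃ K, ∀ {p q : P} (w : (𝒯.copy ⊔ 𝒯.bond).Walk p q), 𝒯.node p = 𝒯.node q → w.length ≤ L →
      𝒯.copy.Within K p q := by
  induction L with
  | zero =>
    refine ⟨0, fun {p q} w _ hw => ?_⟩
    rw [Walk.eq_of_length_eq_zero (Nat.le_zero.1 hw)]
    exact Within.refl _ _ _
  | succ L ih =>
    obtain ⟨K, hK⟩ := ih
    obtain ⟨K', hK'⟩ := h K
    refine ⟨1 + K + K', fun {p q} w hpq hw => ?_⟩
    cases w with
    | nil => exact Within.refl _ _ _
    | @cons _ p' _ hadj w =>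
      rw [Walk.length_cons] at hw
      rcases hadj with hadj | hadj
      · exact hadj.within.trans (hK w ((𝒯.copy_adj _ _ hadj).symm.trans hpq) (by omega)) (by omega)
      · have finish : ∀ a b, 𝒯.bond.Adj a b → 𝒯.node a = 𝒯.node p' → 𝒯.node b = 𝒯.node p →
            ∀ (w₁ : (𝒯.copy ⊔ 𝒯.bond).Walk p' a) (w₂ : (𝒯.copy ⊔ 𝒯.bond).Walk b q),
            w₁.length + 1 + w₂.length = w.length → 𝒯.copy.Within (1 + K + K') p q := by
          intro a b hab ha hb w₁ w₂ hlen
          have h1 := hK w₁ ha.symm (by omega)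
          have h2 := hK' p' p a b hadj.symm hab ha.symm hb.symm h1
          exact h2.trans (hK w₂ (hb.trans hpq) (by omega)) (by omega)
        -- After a bond upwards the walk must re-enter the subtree below the node of `p`; after a
        -- bond downwards it must leave the one below the node of `p'`.
        rcases 𝒯.bond_adj _ _ hadj with ⟨h1, h2⟩ | ⟨h1, h2⟩
        · obtain ⟨a, b, ha, hb, hab, w₁, w₂, hlen⟩ :=
            w.exists_exit {x | ¬𝒯.Below (𝒯.node p) (𝒯.node x)}
              (fun hbel => by have := hbel.1; omega) (fun hn => hn (hpq ▸ Below.refl _))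
          have hb' : 𝒯.Below (𝒯.node p) (𝒯.node b) := not_not.1 hb
          rcases hab with hab | hab
          · exact absurd (𝒯.copy_adj _ _ hab ▸ hb') ha
          · obtain ⟨h3, h4⟩ := eq_of_bond_of_below hab.symm hb' ha
            exact finish a b hab (h4.trans h1.symm) h3 w₁ w₂ hlen
        · obtain ⟨a, b, ha, hb, hab, w₁, w₂, hlen⟩ :=
            w.exists_exit {x | 𝒯.Below (𝒯.node p') (𝒯.node x)} (Below.refl _)
              (fun hbel => by have := hbel.1; rw [← hpq] at this; omega)
          rcases hab with hab | hab
          · exact absurd (show 𝒯.Below _ _ from 𝒯.copy_adj _ _ hab ▸ ha) hb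
          · obtain ⟨h3, h4⟩ := eq_of_bond_of_below hab ha hb
            exact finish a b hab h3 (h4.trans h1.symm) w₁ w₂ hlen

/-- The nodes are uniformly coarsely embedded into the contracted graph. -/
lemma CoarseBonds.exists_copy_within (h : 𝒯.CoarseBonds) (r : ℕ) :
    ∃ K, ∀ p q : P, 𝒯.node p = 𝒯.node q → 𝒯.contraction.Within r (𝒯.cls p) (𝒯.cls q) →
      𝒯.copy.Within K p q := by
  obtain ⟨K, hK⟩ := h.exists_copy_within_of_walk ((2 * 𝒯.size + 1) * r + 2 * 𝒯.size)
  refine ⟨K, fun p q hpq hr => ?_⟩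
  obtain ⟨w, hw⟩ := (sup_within_of_cls_within hr).exists_walk
  exact hK w hpq hw

end RootedTreeOfGraphs

/-! ### Truncated distance from a set -/

namespace SimpleGraph

variable {V : Type*} {G : SimpleGraph V}

/-- The distance from the set `O`, truncated at `L`. -/
noncomputable def truncDist (G : SimpleGraph V) (O : Set V) (L : ℕ) (a : V) : ℕ :=
  sInf {i | i = L ∨ ∃ b ∈ O, G.Within i a b}

lemma truncDist_spec (G : SimpleGraph V) (O : Set V) (L : ℕ) (a : V) :
    G.truncDist O L a = L ∨ ∃ b ∈ O, G.Within (G.truncDist O L a) a b :=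
  Nat.sInf_mem (s := {i | i = L ∨ ∃ b ∈ O, G.Within i a b}) ⟨L, Or.inl rfl⟩

lemma truncDist_le (G : SimpleGraph V) (O : Set V) (L : ℕ) (a : V) : G.truncDist O L a ≤ L :=
  Nat.sInf_le (Or.inl rfl)

lemma truncDist_le_of_within {O : Set V} {L i : ℕ} {a b : V} (hb : b ∈ O) (h : G.Within i a b) :
    G.truncDist O L a ≤ i :=
  Nat.sInf_le (Or.inr ⟨b, hb, h⟩)

lemma truncDist_le_add {O : Set V} {L i : ℕ} {a b : V} (h : G.Within i a b) :
    G.truncDist O L a ≤ G.truncDist O L b + i := by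
  rcases truncDist_spec G O L b with h1 | ⟨c, hc, h1⟩
  · have := truncDist_le G O L a
    omega
  · exact truncDist_le_of_within hc (h.trans h1 (by omega))

lemma truncDist_anti {O O' : Set V} (hO : O ⊆ O') (L : ℕ) (a : V) :
    G.truncDist O' L a ≤ G.truncDist O L a := by
  rcases truncDist_spec G O L a with h1 | ⟨c, hc, h1⟩
  · rw [h1]; exact truncDist_le _ _ _ _
  · exact truncDist_le_of_within (hO hc) h1

end SimpleGraph

/-! ### Colourings and asymptotic dimension of the contracted graph -/

namespace RootedTreeOfGraphs

open SimpleGraph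

variable {P T : Type*} {𝒯 : RootedTreeOfGraphs P T}

/-- Colorings of sets in the nodes yield colorings of their neighbourhoods in the contracted
graph. -/
lemma CoarseBonds.hasColoring_near (h : 𝒯.CoarseBonds) {m : ℕ} {E : T → Set P}
    (hE : ∀ t, ∀ p ∈ E t, 𝒯.node p = t) (hcol : ∀ r, ∃ D, ∀ t, 𝒯.copy.HasColoring (E t) m r D)
    (s r : ℕ) : ∃ D, ∀ t, 𝒯.contraction.HasColoring
      {a | ∃ p ∈ E t, 𝒯.contraction.Within s a (𝒯.cls p)} m r D := by
  obtain ⟨K, hK⟩ := h.exists_copy_within (r + 2 * s)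
  obtain ⟨D, hD⟩ := hcol K
  refine ⟨D + 2 * s, fun t => HasColoring.of_near (B := 𝒯.cls '' E t) ?_ ?_⟩
  · have : ∀ a ∈ 𝒯.cls '' E t, ∃ p, p ∈ E t ∧ 𝒯.cls p = a := fun a ha => ha
    rcases isEmpty_or_nonempty P with hP | hP
    · refine (hD t).transfer (fun a => isEmptyElim (Quot.out a)) ?_ ?_ ?_ <;>
        exact fun a => isEmptyElim (Quot.out a)
    choose! f hf hfa using this
    refine (hD t).transfer f hf (fun x hx y hy hxy => ?_) (fun x hx y hy hxy => ?_)
    · refine hK _ _ ((hE t _ (hf x hx)).trans (hE t _ (hf y hy)).symm) ?_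
      rwa [hfa x hx, hfa y hy]
    · rw [← hfa x hx, ← hfa y hy]
      exact 𝒯.cls_within hxy
  · rintro a ⟨p, hp, hap⟩
    exact ⟨_, ⟨p, hp, rfl⟩, hap⟩

variable (𝒯) in
/-- The union of the nodes in the first `m + 1` levels below `t`. -/
def levels (t : T) (m : ℕ) : Set 𝒯.Vtx :=
  {a | ∃ p, 𝒯.cls p = a ∧ 𝒯.Below t (𝒯.node p) ∧ 𝒯.depth (𝒯.node p) ≤ 𝒯.depth t + m}

/-- Induction on the number of levels, by `HasColoring.union`. The new vertices near earlier levels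
are absorbed into a neighbourhood `A` of these. The others form `B`, whose parts in different nodes
are more than `r` apart: a shorter path would pass through a vertex of smaller top depth. -/
lemma CoarseBonds.hasColoring_levels (h : 𝒯.CoarseBonds) {m : ℕ}
    (hcol : ∀ r, ∃ D, ∀ t, 𝒯.copy.HasColoring (𝒯.node ⁻¹' {t}) m r D) (M r : ℕ) :
    ∃ D, ∀ t, 𝒯.contraction.HasColoring (𝒯.levels t M) m r D := by
  induction M generalizing r with
  | zero =>
    obtain ⟨D, hD⟩ := h.hasColoring_near (fun t p hp => hp) hcol 0 r
    refine ⟨D, fun t => (hD t).mono ?_ le_rfl le_rfl le_rfl⟩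
    rintro _ ⟨p, rfl, hp, hd⟩
    exact ⟨p, hp.eq hd, Within.refl _ _ _⟩
  | succ M ih =>
    obtain ⟨d₀, hd₀⟩ := h.hasColoring_near (fun t p hp => hp) hcol 0 r
    -- Passing to the `r`-neighbourhood costs `2 * r` of this scale and leaves the `d₀ + 2 * r`
    -- required for the union.
    obtain ⟨D, hD⟩ := ih (d₀ + 2 * r + 2 * r)
    refine ⟨D + 2 * r + 2 * (d₀ + r), fun t => ?_⟩
    set d := 𝒯.depth t + M + 1 with hd
    let B : Set 𝒯.Vtx := {a | 𝒯.topDepth a = d ∧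
      ∀ b, 𝒯.contraction.Within r a b → d ≤ 𝒯.topDepth b}
    let A : Set 𝒯.Vtx := {a | ∃ b ∈ 𝒯.levels t M, 𝒯.contraction.Within r a b}
    have hB : 𝒯.contraction.HasColoring B m r d₀ := by
      refine HasColoring.of_separated 𝒯.topNode (fun x hx y hy hxy => ?_) fun i => ?_
      · rcases anc_eq_or_exists_near hxy hx.1.ge with ⟨_, h1⟩ | ⟨q, _, _, h3, h4⟩
        · rwa [anc_eq_self hx.1, anc_eq_self hy.1, eq_comm] at h1
        · have := hx.2 _ h4
          omega
      · refine (hd₀ i).mono ?_ le_rfl le_rfl le_rfl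
        rintro a ⟨_, rfl⟩
        obtain ⟨p, hp, hpn⟩ := exists_cls_eq_topNode a
        exact ⟨p, hpn, hp ▸ Within.refl _ _ _⟩
    have hA : 𝒯.contraction.HasColoring A m (d₀ + 2 * r) (D + 2 * r) :=
      (hD t).of_near fun a ha => ha
    have hup : ∀ q, 𝒯.up q ≠ q → 𝒯.Below t (𝒯.node q) → 𝒯.depth (𝒯.node q) = d →
        𝒯.cls q ∈ 𝒯.levels t M := fun q hq hbel hdq => by
      obtain ⟨-, h1, h2⟩ := up_spec hq
      exact ⟨𝒯.up q, cls_up q, by rw [h1]; exact hbel.parent (by omega), by omega⟩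
    refine (hB.union hA).mono ?_ le_rfl le_rfl le_rfl
    rintro _ ⟨p, rfl, hp, hpd⟩
    by_cases hlt : 𝒯.depth (𝒯.node p) ≤ 𝒯.depth t + M
    · exact Or.inl ⟨_, ⟨p, rfl, hp, hlt⟩, Within.refl _ _ _⟩
    have hpd' : 𝒯.depth (𝒯.node p) = d := by omega
    by_cases hpu : 𝒯.up p = p
    · have htop : 𝒯.topNode (𝒯.cls p) = 𝒯.node p := by rw [topNode_cls, top_eq_self hpu]
      have htd : 𝒯.topDepth (𝒯.cls p) = d := by rw [topDepth, htop, hpd']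
      by_cases hpB : 𝒯.cls p ∈ B
      · exact Or.inr hpB
      · obtain ⟨b, hb, hbd⟩ : ∃ b, 𝒯.contraction.Within r (𝒯.cls p) b ∧ 𝒯.topDepth b < d := by
          by_contra! hcon
          exact hpB ⟨htd, hcon⟩
        rcases anc_eq_or_exists_near hb htd.ge with ⟨h1, _⟩ | ⟨q, h1, h2, _, h4⟩
        · omega
        · rw [htop, anc_eq_self hpd'] at h1
          exact Or.inl ⟨_, hup q h2 (h1 ▸ hp) (h1 ▸ hpd'), h4⟩
    · exact Or.inl ⟨_, hup p hpu hp hpd', Within.refl _ _ _⟩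

/-- If the bonds are coarse equivalences, the nodes have asymptotic dimension at most `n` and the
sets of vertices shared with the parents have asymptotic dimension less than `n`, all uniformly,
then the contracted graph has asymptotic dimension at most `n`. -/
theorem CoarseBonds.asdimLE_contraction [Nonempty P] (hbond : 𝒯.CoarseBonds) {n : ℕ}
    (hnode : ∀ r, ∃ D, ∀ t, 𝒯.copy.HasColoring (𝒯.node ⁻¹' {t}) (n + 1) r D)
    (hedge : ∀ r, ∃ D, ∀ t, 𝒯.copy.HasColoring {p | 𝒯.node p = t ∧ 𝒯.up p ≠ p} n r D) :
    letI := graphMetric 𝒯.contraction; AsdimLE 𝒯.Vtx n := by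
  classical
  have : Nonempty 𝒯.Vtx := ⟨𝒯.cls (Classical.arbitrary P)⟩
  refine asdimLE_of_forall_exists_cover fun k hk => ?_
  -- `w` is the width of the boundary strip for `exists_cover_of_partition`. With cuts at distance
  -- `R`, the strip lies at distances from `2 * k + 1` to `2 * R - 2 * k - 1`: steps of length `2 *
  -- k` do not leave its subtree, and the truncation at `2 * R` is not felt. As an edge changes the
  -- top depth by at most `size`, `M` keeps the cuts apart.
  set w := 3 * k * (n + 1) + k with hw
  set R := w + 2 * k + 1 with hR
  set M := 𝒯.size * (2 * R) + 1 with hM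
  let H : ℕ → 𝒯.Vtx → ℕ := fun j a => 𝒯.contraction.truncDist {b | 𝒯.topDepth b < j * M} (2 * R) a
  have H_le : ∀ j a, H j a ≤ 2 * R := fun j a => truncDist_le _ _ _ _
  have H_lip : ∀ j {i a b}, 𝒯.contraction.Within i a b → H j a ≤ H j b + i :=
    fun j _ _ _ hab => truncDist_le_add hab
  have H_anti : ∀ {j j'} a, j ≤ j' → H j' a ≤ H j a := fun {j j'} a hj =>
    truncDist_anti (fun b (hb : _ < _) => lt_of_lt_of_le hb (Nat.mul_le_mul_right M hj)) _ _
  have H_zero : ∀ a, H 0 a = 2 * R := fun a => by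
    rcases truncDist_spec 𝒯.contraction {b | 𝒯.topDepth b < 0 * M} (2 * R) a with h1 | ⟨c, hc, _⟩
    · exact h1
    · simp at hc
  have H_pos : ∀ {j a}, 0 < H j a → j * M ≤ 𝒯.topDepth a := fun {j a} hpos => by
    by_contra hcon
    have : H j a ≤ 0 := truncDist_le_of_within (not_le.1 hcon) (Within.refl _ _ _)
    omega
  -- Top depth at least `(j + 1) * M` means distance more than `2 * R` from top depth less than `j *
  -- M`. So at most one `H j a` lies strictly between `0` and `2 * R`.
  have H_gap : ∀ {j j' a}, j < j' → 0 < H j' a → H j a = 2 * R := fun {j j' a} hj hpos => by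
    rcases truncDist_spec 𝒯.contraction {b | 𝒯.topDepth b < j * M} (2 * R) a with h1 | ⟨c, hc, h1⟩
    · exact h1
    · have h2 := Within.le_add_mul (fun a b hab => topDepth_le_of_adj hab)
        (h1.mono (truncDist_le _ _ _ _))
      have h3 := H_pos (hpos.trans_le (H_anti a (Nat.succ_le_of_lt hj)))
      have h4 : 𝒯.topDepth c < j * M := hc
      rw [Nat.succ_mul] at h3
      omega
  have H_stay : ∀ {j i a b}, 𝒯.contraction.Within i a b → i < H j a → j * M ≤ 𝒯.topDepth b ∧
      𝒯.anc (j * M) (𝒯.topNode b) = 𝒯.anc (j * M) (𝒯.topNode a) := fun {j i a b} hab hi => by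
    rcases anc_eq_or_exists_near hab (H_pos (by omega : 0 < H j a)) with h1 | ⟨q, _, _, h3, h4⟩
    · exact h1
    · have : H j a ≤ i := truncDist_le_of_within h3 h4
      omega
  have hlevel : ∀ a, ∃ l, R ≤ H l a ∧ H (l + 1) a < R := fun a => by
    have hex : ∃ j, H j a < R := by
      refine ⟨𝒯.topDepth a + 1, ?_⟩
      by_contra hcon
      have h1 := H_pos (by omega : 0 < H (𝒯.topDepth a + 1) a)
      have h2 : 𝒯.topDepth a + 1 ≤ (𝒯.topDepth a + 1) * M := Nat.le_mul_of_pos_right _ (by omega)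
      omega
    obtain ⟨l, hl⟩ : ∃ l, Nat.find hex = l + 1 := Nat.exists_eq_succ_of_ne_zero fun h0 => by
      have := Nat.find_spec hex
      rw [h0, H_zero] at this
      omega
    exact ⟨l, not_lt.1 (Nat.find_min hex (by omega)), hl ▸ Nat.find_spec hex⟩
  choose level level_le lt_level using hlevel
  -- The absolute difference of `H j a` and `R`, by truncated subtraction.
  let gap : 𝒯.Vtx → ℕ → ℕ := fun a j => (H j a - R) + (R - H j a)
  let height : 𝒯.Vtx → ℕ := fun a => sInf (Set.range (gap a))
  have height_le : ∀ a j, height a ≤ gap a j := fun a j => Nat.sInf_le ⟨j, rfl⟩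
  have height_eq : ∀ a, ∃ j, gap a j = height a := fun a => Nat.sInf_mem (Set.range_nonempty (gap a))
  obtain ⟨d, hd⟩ := hbond.hasColoring_near (fun t p hp => hp.1) hedge (2 * R) (2 * k)
  refine exists_cover_of_partition (n := n) (d := d) hk
    (fun a => (level a, 𝒯.anc (level a * M) (𝒯.topNode a))) height ?_ ?_ ?_ ?_
  · intro x y hxy
    obtain ⟨j, hj⟩ := height_eq y
    have h1 := height_le x j
    have h2 := H_lip j hxy
    have h3 := H_lip j hxy.symm
    simp only [gap] at hj h1
    omega
  · intro x y hxy hne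
    rcases lt_trichotomy (level x) (level y) with hlt | heq | hlt
    · have h1 := height_le x (level x + 1)
      have h2 := H_lip (level x + 1) hxy.symm
      have h3 := lt_level x
      have h4 := (level_le y).trans (H_anti y hlt)
      simp only [gap, Nat.succ_eq_add_one] at h1 h4
      omega
    · refine absurd (Prod.ext heq ?_) hne
      have h1 := level_le x
      have h2 := (H_stay hxy (by omega : k < H (level x) x)).2
      simp only [← heq, h2]
    · have h1 := height_le x (level x)
      have h2 := H_lip (level x) hxy
      have h3 := level_le x
      have h4 := lt_level y
      have h5 := H_anti y hlt
      simp only [gap, Nat.succ_eq_add_one] at h1 h5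
      omega
  -- The boundary strip: `lev a` is the cut nearest to `a`. Parts at different cuts or below
  -- different nodes are more than `2 * k` apart, and each lies near the vertices that one node
  -- shares with its parent.
  · have hex : ∀ a, ∃ j, height a ≤ w → H j a ≤ R + w ∧ R ≤ H j a + w := fun a => by
      obtain ⟨j, hj⟩ := height_eq a
      refine ⟨j, fun ha => ?_⟩
      simp only [gap] at hj
      omega
    choose lev hlev using hex
    refine HasColoring.of_separated (fun a => (lev a, 𝒯.anc (lev a * M) (𝒯.topNode a))) ?_ ?_
    · intro x hx y hy hxy
      have hx' := hlev x hx
      have hy' := hlev y hy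
      have heq : lev x = lev y := by
        rcases lt_trichotomy (lev x) (lev y) with hlt | heq | hlt
        · have h1 := H_lip (lev y) hxy.symm
          have h2 := H_gap hlt (by omega : 0 < H (lev y) x)
          omega
        · exact heq
        · have h1 := H_lip (lev x) hxy
          have h2 := H_gap hlt (by omega : 0 < H (lev x) y)
          omega
      refine Prod.ext heq ?_
      have h2 := (H_stay hxy (by omega : 2 * k < H (lev x) x)).2
      simp only [← heq, h2]
    · rintro ⟨j, t⟩
      refine (hd t).mono ?_ le_rfl le_rfl le_rfl
      rintro a ⟨ha, hat⟩
      obtain ⟨rfl, rfl⟩ := Prod.ext_iff.1 hat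
      have ha' := hlev a ha
      rcases truncDist_spec 𝒯.contraction {b | 𝒯.topDepth b < lev a * M} (2 * R) a with
        h1 | ⟨c, hc, h1⟩
      · change H (lev a) a = 2 * R at h1
        omega
      · rcases anc_eq_or_exists_near h1 (H_pos (by omega : 0 < H (lev a) a)) with
          ⟨h2, _⟩ | ⟨q, h2, h3, _, h5⟩
        · exact absurd hc (not_lt.2 h2)
        · exact ⟨q, ⟨h2, h3⟩, h5.mono (H_le _ _)⟩
  -- Since `H (level a + 1) a < R ≤ H (level a) a`, a shortest way to top depth less than `(level a
  -- + 1) * M` stays in the subtree. Hence a piece lies near the first levels below its node.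
  · intro r
    obtain ⟨D, hD⟩ := hbond.hasColoring_levels hnode M (r + 2 * R)
    refine ⟨D + 2 * R, ?_⟩
    rintro ⟨j, t⟩
    refine (hD t).of_near ?_
    intro a ha
    obtain ⟨rfl, rfl⟩ := Prod.ext_iff.1 ha
    have h1 := level_le a
    have h2 := lt_level a
    rcases truncDist_spec 𝒯.contraction {b | 𝒯.topDepth b < (level a + 1) * M} (2 * R) a with
      h3 | ⟨c, hc, h3⟩
    · change H (level a + 1) a = 2 * R at h3
      omega
    · change 𝒯.contraction.Within (H (level a + 1) a) a c at h3
      obtain ⟨h4, h5⟩ := H_stay h3 (by omega : H (level a + 1) a < H (level a) a)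
      refine ⟨c, ?_, h3.mono (by omega)⟩
      obtain ⟨p, hp, hpn⟩ := exists_cls_eq_topNode c
      have hda := depth_anc (𝒯 := 𝒯) (H_pos (by omega : 0 < H (level a) a))
      refine ⟨p, hp, ?_, ?_⟩
      · simp only
        rw [hpn, ← h5]
        exact below_anc h4
      · have hc' : 𝒯.topDepth c < (level a + 1) * M := hc
        simp only
        rw [hpn, hda]
        rw [Nat.succ_mul] at hc'
        exact hc'.le

end RootedTreeOfGraphs

/-! ### Coarse geometry of the bonding maps -/

section Actions

open SimpleGraph

variable {V V' I I' Γ Γ' : Type*} [Group Γ] [MulAction Γ V] [Group Γ'] [MulAction Γ' V']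
  {G : SimpleGraph V} {G' : SimpleGraph V'} {S : I → Set V} {S' : I' → Set V'}

lemma ActsOnGraph.within_smul (h : ActsOnGraph Γ G) (γ : Γ) {r : ℕ} {x y : V}
    (hxy : G.Within r x y) : G.Within r (γ • x) (γ • y) :=
  hxy.map (γ • ·) fun a b hab => (h γ a b).2 hab

lemma ActsOnGraph.within_smul_iff (h : ActsOnGraph Γ G) (γ : Γ) {r : ℕ} {x y : V} :
    G.Within r (γ • x) (γ • y) ↔ G.Within r x y :=
  ⟨fun hxy => by simpa using h.within_smul γ⁻¹ hxy, h.within_smul γ⟩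

/-- Finitely many vertices represent all orbits. -/
lemma ActsQuasiTransitively.exists_finite_reps (h : ActsQuasiTransitively Γ G) :
    ∃ X : Set V, X.Finite ∧ ∀ x : V, ∃ γ : Γ, γ • x ∈ X := by
  have := h.2
  refine ⟨Set.range fun q : MulAction.orbitRel.Quotient Γ V => Quotient.out q,
    Set.finite_range _, fun x => ?_⟩
  have h1 : (MulAction.orbitRel Γ V).r (Quotient.out (Quotient.mk _ x)) x := Quotient.mk_out x
  obtain ⟨γ, hγ⟩ := h1
  exact ⟨γ, Quotient.mk _ x, hγ.symm⟩

lemma Set.Finite.exists_uniform_bound {α : Type*} {F : Set α} (hF : F.Finite) {Q : α → ℕ → Prop}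
    (hmono : ∀ a K K', K ≤ K' → Q a K → Q a K') (h : ∀ a ∈ F, ∃ K, Q a K) :
    ∃ K, ∀ a ∈ F, Q a K := by
  choose! f hf using h
  obtain ⟨K, hK⟩ := (hF.image f).bddAbove
  exact ⟨K, fun a ha => hmono a _ _ (hK ⟨a, ha, rfl⟩) (hf a ha)⟩

/-- Bonding maps that are respected and consistent do not increase distances too much. -/
lemma exists_within_of_respectsElement (hfin : ∀ x, (G.neighborSet x).Finite)
    (hconn : G'.Connected) (hact : ActsQuasiTransitively Γ G) (hact' : ActsOnGraph Γ' G')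
    (φ : ∀ k l, S k ≃ S' l) (R : I → I' → Prop) (hS : ∀ x, {k | x ∈ S k}.Finite)
    (hresp : ∀ γ : Γ, RespectsElement Γ' φ R γ) (hcons : ConsistentBonds Γ' φ R) (r : ℕ) :
    ∃ K, ∀ k l, R k l → ∀ x z : S k, G.Within r x z → G'.Within K (φ k l x) (φ k l z) := by
  obtain ⟨X, hX, hXrep⟩ := hact.exists_finite_reps
  -- Up to the action, these triples represent every pair to be bounded.
  have hF : {f : V × I × V | f.1 ∈ X ∧ f.1 ∈ S f.2.1 ∧ G.Within r f.1 f.2.2}.Finite := by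
    refine (hX.biUnion fun x _ => ((Set.finite_singleton x).prod
      ((hS x).prod (finite_setOf_within hfin r x)))).subset ?_
    rintro ⟨x, m, z⟩ ⟨h1, h2, h3⟩
    exact Set.mem_biUnion h1 ⟨rfl, h2, h3⟩
  obtain ⟨K, hK⟩ := hF.exists_uniform_bound (Q := fun f K => ∀ l, R f.2.1 l →
      ∀ (hx : f.1 ∈ S f.2.1) (hz : f.2.2 ∈ S f.2.1),
        G'.Within K (φ f.2.1 l ⟨f.1, hx⟩) (φ f.2.1 l ⟨f.2.2, hz⟩))
    (fun _ _ _ hKK' hQ l hl hx hz => (hQ l hl hx hz).mono hKK') (by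
      rintro ⟨x, m, z⟩ ⟨-, hx, -⟩
      by_cases hex : z ∈ S m ∧ ∃ l, R m l
      · obtain ⟨hz, l₀, hl₀⟩ := hex
        obtain ⟨K, hK⟩ := hconn.exists_within (φ m l₀ ⟨x, hx⟩ : V') (φ m l₀ ⟨z, hz⟩)
        refine ⟨K, fun l hl hx hz => ?_⟩
        -- By consistency, changing the label `l` composes the bonding map with an automorphism of
        -- `G'`, so one `l₀` gives the bound for all.
        obtain ⟨γ, hγ⟩ := hcons m l l₀ hl hl₀
        simp only at hx hz ⊢
        rw [hγ, hγ]
        exact hact'.within_smul γ hK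
      · exact ⟨0, fun l hl _ hz => absurd ⟨hz, l, hl⟩ hex⟩)
  refine ⟨K, fun k l hkl x z hxz => ?_⟩
  obtain ⟨γ, hγ⟩ := hXrep x
  obtain ⟨σ, hσ⟩ := hresp γ
  obtain ⟨l', hkl', hσl', τ, -, hτ⟩ := hσ k
  obtain ⟨hx, hφx⟩ := hτ x
  obtain ⟨hz, hφz⟩ := hτ z
  obtain ⟨ρ, hρ⟩ := hcons k l l' hkl hkl'
  rw [hρ, hρ, hφx, hφz]
  exact hact'.within_smul ρ (hact'.within_smul τ
    (hK (γ • (x : V), σ k, γ • (z : V)) ⟨hγ, hx, hact.1.within_smul γ hxz⟩ l' hσl' hx hz))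

lemma SimpleGraph.HasColoring.empty (G : SimpleGraph V) (m r D : ℕ) : G.HasColoring ∅ m r D := by
  refine ⟨fun _ => 0, fun x hx => hx.elim, fun x y hxy => ?_⟩
  rcases hxy.cases_head with rfl | ⟨z, hz, _⟩
  · exact Within.refl _ _ _
  · exact hz.1.elim

/-- If the adhesion sets are respected, then colorings of them can be chosen uniformly. -/
lemma exists_uniform_hasColoring (hact : ActsQuasiTransitively Γ G) (φ : ∀ k l, S k ≃ S' l)
    (R : I → I' → Prop) (hS : ∀ x, {k | x ∈ S k}.Finite)
    (hresp : ∀ γ : Γ, RespectsElement Γ' φ R γ) {m : ℕ}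
    (hcol : ∀ k r, ∃ D, G.HasColoring (S k) m r D) (r : ℕ) :
    ∃ D, ∀ k, G.HasColoring (S k) m r D := by
  obtain ⟨X, hX, hXrep⟩ := hact.exists_finite_reps
  -- Every nonempty adhesion set is moved into one that meets `X`, and there are finitely many of
  -- those.
  obtain ⟨D, hD⟩ := (hX.biUnion fun x _ => hS x).exists_uniform_bound
    (Q := fun k D => G.HasColoring (S k) m r D)
    (fun k D D' hDD' h => h.mono subset_rfl le_rfl le_rfl hDD') (fun k _ => hcol k r)
  refine ⟨D, fun k => ?_⟩
  rcases (S k).eq_empty_or_nonempty with hk | ⟨x, hx⟩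
  · rw [hk]; exact HasColoring.empty G m r D
  obtain ⟨γ, hγ⟩ := hXrep x
  obtain ⟨σ, hσ⟩ := hresp γ
  obtain ⟨l, -, -, τ, -, hτ⟩ := hσ k
  have hmem : ∀ y ∈ S k, γ • y ∈ S (σ k) := fun y hy => (hτ ⟨y, hy⟩).1
  exact (hD (σ k) (Set.mem_biUnion hγ (hmem x hx))).transfer (γ • ·) hmem
    (fun y _ z _ hyz => hact.1.within_smul γ hyz)
    (fun y _ z _ hyz => (hact.1.within_smul_iff γ).1 hyz)

/-- Colorings can be transferred along coarse equivalences. -/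
lemma exists_hasColoring_of_equiv {A : Set V} {A' : Set V'} (e : A ≃ A')
    (he : ∀ r, ∃ K, ∀ x z : A, G.Within r x z → G'.Within K (e x) (e z))
    (he' : ∀ r, ∃ K, ∀ x z : A', G'.Within r x z → G.Within K (e.symm x) (e.symm z)) {m : ℕ}
    (h : ∀ r, ∃ D, G'.HasColoring A' m r D) (r : ℕ) : ∃ D, G.HasColoring A m r D := by
  classical
  rcases A.eq_empty_or_nonempty with rfl | ⟨x₀, hx₀⟩
  · exact ⟨0, HasColoring.empty G m r 0⟩
  obtain ⟨K, hK⟩ := he r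
  obtain ⟨D', hD'⟩ := h K
  obtain ⟨D, hD⟩ := he' D'
  let f : V → V' := fun x => if hx : x ∈ A then e ⟨x, hx⟩ else e ⟨x₀, hx₀⟩
  have hf : ∀ x (hx : x ∈ A), f x = e ⟨x, hx⟩ := fun x hx => dif_pos hx
  refine ⟨D, hD'.transfer f (fun x hx => ?_) (fun x hx z hz hxz => ?_) (fun x hx z hz hxz => ?_)⟩
  · rw [hf x hx]; exact (e ⟨x, hx⟩).2
  · rw [hf x hx, hf z hz]; exact hK ⟨x, hx⟩ ⟨z, hz⟩ hxz
  · rw [hf x hx, hf z hz] at hxz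
    simpa using hD (e ⟨x, hx⟩) (e ⟨z, hz⟩) hxz

end Actions

/-! ### Tree amalgamations as rooted trees of graphs -/

/-- Depth is the distance from a fixed root, and the parent is the second vertex of a geodesic to
it; uniqueness of paths identifies it with any neighbour closer to the root. The root is its own
parent. -/
lemma SimpleGraph.IsTree.exists_depth_parent {T : Type*} {Tr : SimpleGraph T} (hT : Tr.IsTree) :
    ∃ (depth : T → ℕ) (parent : T → T), (∀ t, depth (parent t) = depth t - 1) ∧
      ∀ s t, Tr.Adj s t → (t = parent s ∧ depth s = depth t + 1) ∨
        (s = parent t ∧ depth t = depth s + 1) := by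
  have hne := hT.connected.nonempty
  let o : T := Classical.arbitrary T
  choose path hpath using fun t => hT.connected.exists_path_of_dist t o
  have hsnd : ∀ s t, Tr.Adj s t → Tr.dist s o = Tr.dist t o + 1 → t = (path s).snd := by
    intro s t hst hd
    have hp : (SimpleGraph.Walk.cons hst (path t)).IsPath :=
      SimpleGraph.Walk.isPath_of_length_eq_dist _ (by simp [(hpath t).2, hd])
    have := (hT.isAcyclic.subsingleton_path s o).elim ⟨_, hp⟩ ⟨_, (hpath s).1⟩
    rw [Subtype.mk.injEq] at this
    rw [← this]
    simp
  have hdist : ∀ {t} (w : Tr.Walk t o), w.length = Tr.dist t o →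
      Tr.dist w.snd o = Tr.dist t o - 1 := by
    intro t w hw
    cases w with
    | nil => simp
    | cons hadj w =>
      have h1 := SimpleGraph.dist_le w
      have h2 := hadj.diff_dist_adj (u := o)
      rw [SimpleGraph.Walk.length_cons] at hw
      rw [SimpleGraph.dist_comm (u := o), SimpleGraph.dist_comm (u := o)] at h2
      rw [SimpleGraph.Walk.snd_cons]
      omega
  refine ⟨fun t => Tr.dist t o, fun t => (path t).snd, fun t => hdist _ (hpath t).2,
    fun s t hst => ?_⟩
  · rcases hT.dist_eq_dist_add_one_of_adj o hst with h | h
    · rw [SimpleGraph.dist_comm, SimpleGraph.dist_comm (u := o)] at h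
      exact Or.inl ⟨hsnd s t hst h, h⟩
    · rw [SimpleGraph.dist_comm, SimpleGraph.dist_comm (u := o)] at h
      exact Or.inr ⟨hsnd t s hst.symm h, h⟩

namespace AmalgamData

open SimpleGraph

variable {V₁ V₂ I₁ I₂ W₁ W₂ : Type*} (D : AmalgamData V₁ V₂ I₁ I₂ W₁ W₂)
  (G₁ : SimpleGraph V₁) (G₂ : SimpleGraph V₂)

lemma copies_adj_node {p q} (h : (D.copies G₁ G₂).Adj p q) : node p = node q := by
  rcases p with ⟨u, x⟩ | ⟨w, y⟩ <;> rcases q with ⟨u', x'⟩ | ⟨w', y'⟩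
  · exact congrArg Sum.inl h.1
  · exact h.elim
  · exact h.elim
  · exact congrArg Sum.inr h.1

lemma bonds_adj_node {p q} (h : D.bonds.Adj p q) : D.tree.Adj (node p) (node q) := by
  rcases p with ⟨u, x⟩ | ⟨w, y⟩ <;> rcases q with ⟨u', x'⟩ | ⟨w', y'⟩
  · exact h.elim
  · exact h.1
  · exact h.1.symm
  · exact h.elim

lemma bonds_unique {p q q'} (h : D.bonds.Adj p q) (h' : D.bonds.Adj p q')
    (hn : node q = node q') : q = q' := by
  rcases p with ⟨u, x⟩ | ⟨w, y⟩ <;> rcases q with ⟨u', x'⟩ | ⟨w', y'⟩ <;>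
    rcases q' with ⟨u'', x''⟩ | ⟨w'', y''⟩
  all_goals first | exact h.elim | exact h'.elim | skip
  · obtain rfl : w' = w'' := Sum.inr_injective hn
    obtain ⟨-, hx, hy⟩ := h
    obtain ⟨-, hx', hy'⟩ := h'
    rw [show y' = y'' from hy.symm.trans hy']
  · obtain rfl : u' = u'' := Sum.inl_injective hn
    obtain ⟨-, hx, hy⟩ := h
    obtain ⟨-, hx', hy'⟩ := h'
    have := (D.φ _ _).injective (Subtype.ext (hy.trans hy'.symm))
    simp only [Subtype.mk.injEq] at this
    rw [this]

/-- A rooting of the connecting tree, together with a bound for the identification sizes. -/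
structure Rooting where
  /-- the distance from the root -/
  depth : W₁ ⊕ W₂ → ℕ
  /-- the parent of a node -/
  parent : W₁ ⊕ W₂ → W₁ ⊕ W₂
  depth_parent : ∀ t, depth (parent t) = depth t - 1
  adj : ∀ s t, D.tree.Adj s t → (t = parent s ∧ depth s = depth t + 1) ∨
    (s = parent t ∧ depth t = depth s + 1)
  /-- the bound for the identification sizes -/
  size : ℕ
  encard_le : ∀ a : D.Vertex, (D.nodesOf a).encard ≤ size

lemma FiniteIdentification.nonempty_rooting {D : AmalgamData V₁ V₂ I₁ I₂ W₁ W₂}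
    (h : D.FiniteIdentification) : Nonempty D.Rooting := by
  obtain ⟨N, hN⟩ := h
  obtain ⟨depth, parent, hdp, hadj⟩ := D.isTree.exists_depth_parent
  exact ⟨⟨depth, parent, hdp, hadj, N, hN⟩⟩

/-- The tree amalgamation as a rooted tree of graphs. -/
abbrev rooted (ρ : D.Rooting) : RootedTreeOfGraphs ((W₁ × V₁) ⊕ (W₂ × V₂)) (W₁ ⊕ W₂) where
  copy := D.copies G₁ G₂
  bond := D.bonds
  node := node
  depth := ρ.depth
  parent := ρ.parent
  depth_parent := ρ.depth_parent
  copy_adj _ _ h := D.copies_adj_node G₁ G₂ h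
  bond_adj _ _ h := ρ.adj _ _ (D.bonds_adj_node h)
  bond_unique _ _ _ h h' hn := D.bonds_unique h h' hn
  size := ρ.size
  encard_le := ρ.encard_le

variable {D G₁ G₂}

lemma copies_within_inl_iff {r : ℕ} {u u' : W₁} {x y : V₁} :
    (D.copies G₁ G₂).Within r (Sum.inl (u, x)) (Sum.inl (u', y)) ↔ u = u' ∧ G₁.Within r x y := by
  constructor
  · intro h
    obtain ⟨w, hw⟩ := h.exists_walk
    have key : ∀ {p q} (w : (D.copies G₁ G₂).Walk p q), ∀ u x u' y, p = Sum.inl (u, x) →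
        q = Sum.inl (u', y) → u = u' ∧ G₁.Within w.length x y := by
      intro p q w
      induction w with
      | nil =>
        rintro u x u' y rfl h
        obtain ⟨rfl, rfl⟩ := Prod.mk.inj (Sum.inl_injective h)
        exact ⟨rfl, Within.refl _ _ _⟩
      | @cons _ v _ hadj w ih =>
        rintro u x u' y rfl rfl
        rcases v with ⟨v, z⟩ | ⟨v, z⟩
        · obtain ⟨h1, h2⟩ := ih v z u' y rfl rfl
          exact ⟨hadj.1.trans h1, (Adj.within hadj.2).trans h2 (by rw [Walk.length_cons]; omega)⟩
        · exact hadj.elim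
    obtain ⟨h1, h2⟩ := key w u x u' y rfl rfl
    exact ⟨h1, h2.mono hw⟩
  · rintro ⟨rfl, h⟩
    exact h.map (fun z => Sum.inl (u, z)) fun a b hab => ⟨rfl, hab⟩

lemma copies_within_inr_iff {r : ℕ} {w w' : W₂} {x y : V₂} :
    (D.copies G₁ G₂).Within r (Sum.inr (w, x)) (Sum.inr (w', y)) ↔ w = w' ∧ G₂.Within r x y := by
  constructor
  · intro h
    obtain ⟨w, hw⟩ := h.exists_walk
    have key : ∀ {p q} (w : (D.copies G₁ G₂).Walk p q), ∀ u x u' y, p = Sum.inr (u, x) →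
        q = Sum.inr (u', y) → u = u' ∧ G₂.Within w.length x y := by
      intro p q w
      induction w with
      | nil =>
        rintro u x u' y rfl h
        obtain ⟨rfl, rfl⟩ := Prod.mk.inj (Sum.inr_injective h)
        exact ⟨rfl, Within.refl _ _ _⟩
      | @cons _ v _ hadj w ih =>
        rintro u x u' y rfl rfl
        rcases v with ⟨v, z⟩ | ⟨v, z⟩
        · exact hadj.elim
        · obtain ⟨h1, h2⟩ := ih v z u' y rfl rfl
          exact ⟨hadj.1.trans h1, (Adj.within hadj.2).trans h2 (by rw [Walk.length_cons]; omega)⟩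
    obtain ⟨h1, h2⟩ := key w _ x _ y rfl rfl
    exact ⟨h1, h2.mono hw⟩
  · rintro ⟨rfl, h⟩
    exact h.map (fun z => Sum.inr (w, z)) fun a b hab => ⟨rfl, hab⟩

/-- By finite identification, every vertex lies in finitely many adhesion sets. -/
lemma FiniteIdentification.finite_setOf_mem₁ (h : D.FiniteIdentification) (u : W₁) (x : V₁) :
    {k | x ∈ D.S₁ k}.Finite := by
  obtain ⟨N, hN⟩ := h
  -- `f k` is the neighbour along the edge labelled `k`. The class of `x` meets its copy if `x` lies
  -- in `S₁ k`, and different labels give different neighbours.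
  choose f hf using fun k => (D.lab₁_unique u k).exists
  have hfin : (D.nodesOf (D.proj (Sum.inl (u, x)))).Finite :=
    Set.finite_of_encard_le_coe (hN _)
  refine Set.Finite.of_finite_image (f := fun k => (Sum.inr (f k) : W₁ ⊕ W₂))
    (hfin.subset ?_) ?_
  · rintro _ ⟨k, hk, rfl⟩
    have hk' : x ∈ D.S₁ (D.lab₁ u (f k)) := by rw [(hf k).2]; exact hk
    have hadj : D.bonds.Adj (Sum.inl (u, x)) (Sum.inr (f k, (D.φ _ (D.lab₂ (f k) u) ⟨x, hk'⟩ : V₂))) :=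
      ⟨(hf k).1, hk', rfl⟩
    exact ⟨_, rfl, (ConnectedComponent.sound hadj.reachable).symm⟩
  · intro k _ k' _ hkk'
    have : f k = f k' := Sum.inr_injective hkk'
    rw [← (hf k).2, ← (hf k').2, this]

lemma FiniteIdentification.finite_setOf_mem₂ (h : D.FiniteIdentification) (w : W₂) (y : V₂) :
    {l | y ∈ D.S₂ l}.Finite := by
  obtain ⟨N, hN⟩ := h
  choose f hf using fun l => (D.lab₂_unique w l).exists
  have hfin : (D.nodesOf (D.proj (Sum.inr (w, y)))).Finite :=
    Set.finite_of_encard_le_coe (hN _)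
  refine Set.Finite.of_finite_image (f := fun l => (Sum.inl (f l) : W₁ ⊕ W₂))
    (hfin.subset ?_) ?_
  · rintro _ ⟨l, hl, rfl⟩
    have hl' : y ∈ D.S₂ (D.lab₂ w (f l)) := by rw [(hf l).2]; exact hl
    have hadj : D.bonds.Adj (Sum.inl (f l, ((D.φ (D.lab₁ (f l) w) _).symm ⟨y, hl'⟩ : V₁)))
        (Sum.inr (w, y)) :=
      ⟨(hf l).1, Subtype.coe_prop _, by simp⟩
    exact ⟨_, rfl, ConnectedComponent.sound hadj.reachable⟩
  · intro k _ k' _ hkk'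
    have : f k = f k' := Sum.inl_injective hkk'
    rw [← (hf k).2, ← (hf k').2, this]

section Respect

variable {Γ₁ Γ₂ : Type*} [Group Γ₁] [MulAction Γ₁ V₁] [Group Γ₂] [MulAction Γ₂ V₂]

/-- Both types of respecting the actions are described by a relation `R`. If colorings pass between
related adhesion sets, then they pass from one adhesion set to all of them. -/
lemma RespectsActions.exists_rel (h : D.RespectsActions G₁ G₂ Γ₁ Γ₂) :
    ∃ R : I₁ → I₂ → Prop, D.RespectsAndConsistent Γ₁ Γ₂ R ∧
      (∀ u w, D.tree.Adj (Sum.inl u) (Sum.inr w) → R (D.lab₁ u w) (D.lab₂ w u)) ∧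
      ∀ m, (∃ u w, D.tree.Adj (Sum.inl u) (Sum.inr w)) →
        (∀ k l, R k l → ((∀ r, ∃ K, G₁.HasColoring (D.S₁ k) m r K) ↔
          ∀ r, ∃ K, G₂.HasColoring (D.S₂ l) m r K)) →
        ((∃ k, ∀ r, ∃ K, G₁.HasColoring (D.S₁ k) m r K) ∨
          ∃ l, ∀ r, ∃ K, G₂.HasColoring (D.S₂ l) m r K) →
        (∀ k r, ∃ K, G₁.HasColoring (D.S₁ k) m r K) ∧
          ∀ l r, ∃ K, G₂.HasColoring (D.S₂ l) m r K := by
  rcases h with h | ⟨α, β, ι, J, -, hS, hlab, h⟩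
  · refine ⟨_, h, fun _ _ _ => trivial, fun m ⟨u, w, _⟩ hiff hex => ?_⟩
    have h1 : ∀ r, ∃ K, G₁.HasColoring (D.S₁ (D.lab₁ u w)) m r K := by
      rcases hex with ⟨k, hk⟩ | ⟨l, hl⟩
      · exact (hiff _ (D.lab₂ w u) trivial).2 ((hiff k _ trivial).1 hk)
      · exact (hiff _ l trivial).2 hl
    have h2 : ∀ l r, ∃ K, G₂.HasColoring (D.S₂ l) m r K := fun l => (hiff _ l trivial).1 h1
    exact ⟨fun k => (hiff k (D.lab₂ w u) trivial).2 (h2 _), h2⟩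
  · refine ⟨_, h, hlab, fun m ⟨u, w, huw⟩ hiff hex => ?_⟩
    have hα : ∀ {r x y}, G₂.Within r (α x) (α y) ↔ G₁.Within r x y := fun {r x y} =>
      ⟨fun hxy => by simpa using hxy.map α.symm fun a b hab => α.symm.map_adj_iff.2 hab,
        fun hxy => hxy.map α fun a b hab => α.map_adj_iff.2 hab⟩
    have hι : ∀ k, (∀ r, ∃ K, G₁.HasColoring (D.S₁ k) m r K) ↔
        ∀ r, ∃ K, G₂.HasColoring (D.S₂ (ι k)) m r K := by
      intro k
      refine forall_congr' fun r => exists_congr fun K => ⟨fun hc => ?_, fun hc => ?_⟩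
      · refine hc.transfer α.symm (fun y hy => ?_) (fun x _ y _ hxy => ?_) (fun x _ y _ hxy => ?_)
        · rw [hS] at hy
          obtain ⟨x, hx, rfl⟩ := hy
          simpa using hx
        · rw [← hα]; simpa using hxy
        · rw [← hα] at hxy; simpa using hxy
      · refine hc.transfer α (fun x hx => ?_) (fun x _ y _ hxy => hα.2 hxy)
          (fun x _ y _ hxy => hα.1 hxy)
        rw [hS]
        exact ⟨x, hx, rfl⟩
    have hmem : ∀ k, ι k ∈ ι '' J ↔ k ∈ J := fun k => ι.injective.mem_set_image
    have hstep : ∀ k k', (k ∈ J ↔ k' ∉ J) → ((∀ r, ∃ K, G₁.HasColoring (D.S₁ k) m r K) →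
        ∀ r, ∃ K, G₁.HasColoring (D.S₁ k') m r K) := by
      intro k k' hkk' hk
      refine (hι k').2 ((hiff k (ι k') ?_).1 hk)
      rwa [hmem]
    obtain ⟨k₀, hk₀⟩ : ∃ k₀, ∀ r, ∃ K, G₁.HasColoring (D.S₁ k₀) m r K := by
      rcases hex with ⟨k, hk⟩ | ⟨l, hl⟩
      · exact ⟨k, hk⟩
      · refine ⟨ι.symm l, (hι _).2 ?_⟩
        simpa using hl
    have hall : ∀ k r, ∃ K, G₁.HasColoring (D.S₁ k) m r K := by
      intro k
      have h1 := hlab u w huw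
      obtain ⟨k₂, hk₂⟩ := ι.surjective (D.lab₂ w u)
      rw [← hk₂, hmem] at h1
      set k₁ := D.lab₁ u w
      -- The labels `k₁` and `k₂` come from a tree edge and lie on different sides of `J`. So labels
      -- on the same side are linked through whichever of the two lies on the other.
      by_cases h0 : k₀ ∈ J ↔ k ∉ J
      · exact hstep k₀ k h0 hk₀
      · by_cases h2 : k₀ ∈ J ↔ k₁ ∈ J
        · exact hstep k₂ k (by tauto) (hstep k₀ k₂ (by tauto) hk₀)
        · exact hstep k₁ k (by tauto) (hstep k₀ k₁ (by tauto) hk₀)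
    refine ⟨hall, fun l => ?_⟩
    obtain ⟨k, rfl⟩ := ι.surjective l
    exact (hι k).1 (hall k)

end Respect

end AmalgamData

/-! ### Asymptotic dimension of tree amalgamations that respect the actions -/

namespace AmalgamData

open SimpleGraph

variable {V₁ V₂ I₁ I₂ W₁ W₂ : Type*} {D : AmalgamData V₁ V₂ I₁ I₂ W₁ W₂}
  {G₁ : SimpleGraph V₁} {G₂ : SimpleGraph V₂} {Γ₁ Γ₂ : Type*}
  [Group Γ₁] [MulAction Γ₁ V₁] [Group Γ₂] [MulAction Γ₂ V₂]

lemma exists_adj_of_bonds_adj {p q} (h : D.bonds.Adj p q) :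
    ∃ u w, D.tree.Adj (Sum.inl u) (Sum.inr w) := by
  rcases p with ⟨u, x⟩ | ⟨w, y⟩ <;> rcases q with ⟨u', x'⟩ | ⟨w', y'⟩
  · exact h.elim
  · exact ⟨u, w', h.1⟩
  · exact ⟨u', w, h.1⟩
  · exact h.elim

lemma coarseBonds_rooted (ρ : D.Rooting)
    (h₁ : ∀ r, ∃ K, ∀ u w, D.tree.Adj (Sum.inl u) (Sum.inr w) → ∀ x z : D.S₁ (D.lab₁ u w),
      G₁.Within r x z → G₂.Within K (D.φ (D.lab₁ u w) (D.lab₂ w u) x)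
        (D.φ (D.lab₁ u w) (D.lab₂ w u) z))
    (h₂ : ∀ r, ∃ K, ∀ u w, D.tree.Adj (Sum.inl u) (Sum.inr w) → ∀ x z : D.S₂ (D.lab₂ w u),
      G₂.Within r x z → G₁.Within K ((D.φ (D.lab₁ u w) (D.lab₂ w u)).symm x)
        ((D.φ (D.lab₁ u w) (D.lab₂ w u)).symm z)) :
    (D.rooted G₁ G₂ ρ).CoarseBonds := by
  intro r
  obtain ⟨K₁, hK₁⟩ := h₁ r
  obtain ⟨K₂, hK₂⟩ := h₂ r
  refine ⟨max K₁ K₂, fun p p' q q' hp hq hpq hpq' hr => ?_⟩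
  change D.bonds.Adj p p' at hp
  change D.bonds.Adj q q' at hq
  change node p = node q at hpq
  change node p' = node q' at hpq'
  change (D.copies G₁ G₂).Within r p q at hr
  change (D.copies G₁ G₂).Within (max K₁ K₂) p' q'
  rcases p with ⟨u, x⟩ | ⟨w, y⟩ <;> rcases p' with ⟨u', x'⟩ | ⟨w', y'⟩ <;>
    rcases q with ⟨v, a⟩ | ⟨v, b⟩ <;> rcases q' with ⟨v', a'⟩ | ⟨v', b'⟩
  all_goals first | exact hp.elim | exact hq.elim | cases hpq
  · obtain ⟨hadj, hx, hy⟩ := hp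
    obtain ⟨-, ha, hb⟩ := hq
    cases hpq'
    simp only at hadj hx hy ha hb
    rw [copies_within_inr_iff, ← hy, ← hb]
    refine ⟨rfl, (hK₁ u w' hadj ⟨x, hx⟩ ⟨a, ha⟩ ?_).mono (le_max_left _ _)⟩
    exact (copies_within_inl_iff.1 hr).2
  · obtain ⟨hadj, hx, hy⟩ := hp
    obtain ⟨-, ha, hb⟩ := hq
    cases hpq'
    simp only at hadj hx hy ha hb
    rw [copies_within_inl_iff]
    refine ⟨rfl, ?_⟩
    have := hK₂ u' w hadj (D.φ _ _ ⟨x', hx⟩) (D.φ _ _ ⟨a', ha⟩)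
      (by rw [hy, hb]; exact (copies_within_inr_iff.1 hr).2)
    simp only [Equiv.symm_apply_apply] at this
    exact this.mono (le_max_right _ _)

/-- The bonds of a tree amalgamation that respects quasi-transitive actions form uniform coarse
equivalences, and its adhesion sets have colorings as soon as one of them has. -/
lemma RespectsActions.coarseBonds_and_hasColoring (hresp : D.RespectsActions G₁ G₂ Γ₁ Γ₂)
    (hfin₁ : ∀ x, (G₁.neighborSet x).Finite) (hfin₂ : ∀ x, (G₂.neighborSet x).Finite)
    (hconn₁ : G₁.Connected) (hconn₂ : G₂.Connected)
    (hact₁ : ActsQuasiTransitively Γ₁ G₁) (hact₂ : ActsQuasiTransitively Γ₂ G₂)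
    (hident : D.FiniteIdentification) (ρ : D.Rooting) :
    (D.rooted G₁ G₂ ρ).CoarseBonds ∧
    ∀ m, (∃ u w, D.tree.Adj (Sum.inl u) (Sum.inr w)) →
      ((∃ k, ∀ r, ∃ K, G₁.HasColoring (D.S₁ k) m r K) ∨
        ∃ l, ∀ r, ∃ K, G₂.HasColoring (D.S₂ l) m r K) →
      ∀ r, ∃ K, (∀ k, G₁.HasColoring (D.S₁ k) m r K) ∧ ∀ l, G₂.HasColoring (D.S₂ l) m r K := by
  -- A tree edge provides a node on either side, as the finiteness of `{k | x ∈ S k}` requires;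
  -- without one there are no bonds.
  by_cases hE : ∃ u w, D.tree.Adj (Sum.inl u) (Sum.inr w)
  · obtain ⟨R, ⟨hr₁, hr₂, hc₂, hc₁⟩, hlab, hall⟩ := hresp.exists_rel
    have hfinS₁ := hident.finite_setOf_mem₁ hE.choose
    have hfinS₂ := hident.finite_setOf_mem₂ hE.choose_spec.choose
    have hA₁ := exists_within_of_respectsElement hfin₁ hconn₂ hact₁ hact₂.1 D.φ R hfinS₁ hr₁ hc₂
    have hA₂ := exists_within_of_respectsElement hfin₂ hconn₁ hact₂ hact₁.1
      (fun l k => (D.φ k l).symm) (fun l k => R k l) hfinS₂ hr₂ hc₁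
    refine ⟨coarseBonds_rooted ρ (fun r => ?_) (fun r => ?_), fun m _ hex r => ?_⟩
    · obtain ⟨K, hK⟩ := hA₁ r
      exact ⟨K, fun u w huw => hK _ _ (hlab u w huw)⟩
    · obtain ⟨K, hK⟩ := hA₂ r
      exact ⟨K, fun u w huw => hK _ _ (hlab u w huw)⟩
    · have hiff : ∀ k l, R k l → ((∀ r, ∃ K, G₁.HasColoring (D.S₁ k) m r K) ↔
          ∀ r, ∃ K, G₂.HasColoring (D.S₂ l) m r K) := by
        intro k l hkl
        have e₁ : ∀ r, ∃ K, ∀ x z : D.S₁ k, G₁.Within r x z →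
            G₂.Within K (D.φ k l x) (D.φ k l z) := fun r => (hA₁ r).imp fun K hK => hK k l hkl
        have e₂ : ∀ r, ∃ K, ∀ x z : D.S₂ l, G₂.Within r x z →
            G₁.Within K ((D.φ k l).symm x) ((D.φ k l).symm z) :=
          fun r => (hA₂ r).imp fun K hK => hK l k hkl
        exact ⟨fun h => exists_hasColoring_of_equiv (D.φ k l).symm e₂ (by simpa using e₁) h,
          fun h => exists_hasColoring_of_equiv (D.φ k l) e₁ e₂ h⟩
      obtain ⟨hcol₁, hcol₂⟩ := hall m hE hiff hex
      obtain ⟨K₁, hK₁⟩ := exists_uniform_hasColoring hact₁ D.φ R hfinS₁ hr₁ hcol₁ r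
      obtain ⟨K₂, hK₂⟩ := exists_uniform_hasColoring hact₂ (fun l k => (D.φ k l).symm)
        (fun l k => R k l) hfinS₂ hr₂ hcol₂ r
      exact ⟨max K₁ K₂,
        fun k => (hK₁ k).mono subset_rfl le_rfl le_rfl (le_max_left _ _),
        fun l => (hK₂ l).mono subset_rfl le_rfl le_rfl (le_max_right _ _)⟩
  · refine ⟨fun r => ⟨0, fun p p' _ _ hp => absurd (exists_adj_of_bonds_adj hp) hE⟩, ?_⟩
    exact fun m h => absurd h hE

/-- If one of the adhesion sets has colorings with `n` colours, then the tree amalgamation has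
asymptotic dimension at most `n`, provided that both its parts have. -/
lemma RespectsActions.asdimLE_amalgam (hresp : D.RespectsActions G₁ G₂ Γ₁ Γ₂)
    (hfin₁ : ∀ x, (G₁.neighborSet x).Finite) (hfin₂ : ∀ x, (G₂.neighborSet x).Finite)
    (hconn₁ : G₁.Connected) (hconn₂ : G₂.Connected)
    (hact₁ : ActsQuasiTransitively Γ₁ G₁) (hact₂ : ActsQuasiTransitively Γ₂ G₂)
    (hident : D.FiniteIdentification) {n : ℕ}
    (h₁ : ∀ r, ∃ K, G₁.HasColoring Set.univ (n + 1) r K)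
    (h₂ : ∀ r, ∃ K, G₂.HasColoring Set.univ (n + 1) r K)
    (hex : (∃ k, ∀ r, ∃ K, G₁.HasColoring (D.S₁ k) n r K) ∨
      ∃ l, ∀ r, ∃ K, G₂.HasColoring (D.S₂ l) n r K) :
    letI := graphMetric (D.amalgam G₁ G₂); AsdimLE D.Vertex n := by
  obtain ⟨ρ⟩ := hident.nonempty_rooting
  obtain ⟨hbond, hcol⟩ := hresp.coarseBonds_and_hasColoring hfin₁ hfin₂ hconn₁ hconn₂ hact₁ hact₂
    hident ρ
  obtain ⟨x₁⟩ := hconn₁.nonempty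
  obtain ⟨x₂⟩ := hconn₂.nonempty
  have : Nonempty ((W₁ × V₁) ⊕ (W₂ × V₂)) := by
    obtain ⟨u | w⟩ := D.isTree.connected.nonempty
    · exact ⟨Sum.inl (u, x₁)⟩
    · exact ⟨Sum.inr (w, x₂)⟩
  let f₁ : (W₁ × V₁) ⊕ (W₂ × V₂) → V₁ := Sum.elim Prod.snd fun _ => x₁
  let f₂ : (W₁ × V₁) ⊕ (W₂ × V₂) → V₂ := Sum.elim (fun _ => x₂) Prod.snd
  have within₁ : ∀ {u p q r}, node p = (Sum.inl u : W₁ ⊕ W₂) → node q = (Sum.inl u : W₁ ⊕ W₂) →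
      ((D.copies G₁ G₂).Within r p q ↔ G₁.Within r (f₁ p) (f₁ q)) := by
    rintro u (⟨v, x⟩ | ⟨v, x⟩) (⟨v', x'⟩ | ⟨v', x'⟩) r hp hq
    · cases hp
      cases hq
      exact copies_within_inl_iff.trans (and_iff_right rfl)
    · cases hq
    · cases hp
    · cases hp
  have within₂ : ∀ {w p q r}, node p = (Sum.inr w : W₁ ⊕ W₂) → node q = (Sum.inr w : W₁ ⊕ W₂) →
      ((D.copies G₁ G₂).Within r p q ↔ G₂.Within r (f₂ p) (f₂ q)) := by
    rintro w (⟨v, x⟩ | ⟨v, x⟩) (⟨v', x'⟩ | ⟨v', x'⟩) r hp hq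
    · cases hp
    · cases hp
    · cases hq
    · cases hp
      cases hq
      exact copies_within_inr_iff.trans (and_iff_right rfl)
  have transfer₁ : ∀ {u A B m r K}, G₁.HasColoring A m r K →
      (∀ p ∈ B, node p = (Sum.inl u : W₁ ⊕ W₂) ∧ f₁ p ∈ A) →
      (D.copies G₁ G₂).HasColoring B m r K := fun hA hB =>
    hA.transfer f₁ (fun p hp => (hB p hp).2)
      (fun p hp q hq => (within₁ (hB p hp).1 (hB q hq).1).1)
      (fun p hp q hq => (within₁ (hB p hp).1 (hB q hq).1).2)
  have transfer₂ : ∀ {w A B m r K}, G₂.HasColoring A m r K →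
      (∀ p ∈ B, node p = (Sum.inr w : W₁ ⊕ W₂) ∧ f₂ p ∈ A) →
      (D.copies G₁ G₂).HasColoring B m r K := fun hA hB =>
    hA.transfer f₂ (fun p hp => (hB p hp).2)
      (fun p hp q hq => (within₂ (hB p hp).1 (hB q hq).1).1)
      (fun p hp q hq => (within₂ (hB p hp).1 (hB q hq).1).2)
  refine hbond.asdimLE_contraction (n := n) (fun r => ?_) (fun r => ?_)
  · obtain ⟨K₁, hK₁⟩ := h₁ r
    obtain ⟨K₂, hK₂⟩ := h₂ r
    refine ⟨max K₁ K₂, fun t => ?_⟩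
    rcases t with u | w
    · exact transfer₁ (u := u) (hK₁.mono subset_rfl le_rfl le_rfl (le_max_left _ _))
        fun p hp => ⟨hp, Set.mem_univ _⟩
    · exact transfer₂ (w := w) (hK₂.mono subset_rfl le_rfl le_rfl (le_max_right _ _))
        fun p hp => ⟨hp, Set.mem_univ _⟩
  · by_cases hE : ∃ u w, D.tree.Adj (Sum.inl u) (Sum.inr w)
    · obtain ⟨K, hK₁, hK₂⟩ := hcol n hE hex r
      refine ⟨K, fun t => ?_⟩
      -- A vertex with `up p ≠ p` has a bond into the copy at the parent. Either the parent is on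
      -- the other side and `p` lies in the adhesion set of that edge, or no such vertex exists.
      have hnext : ∀ p, (D.rooted G₁ G₂ ρ).node p = t → (D.rooted G₁ G₂ ρ).up p ≠ p →
          ∃ q, D.bonds.Adj p q ∧ node q = ρ.parent t := fun p hp hup => by
        obtain ⟨h1, h2, -⟩ := RootedTreeOfGraphs.up_spec hup
        exact ⟨_, h1, h2.trans (congrArg _ hp)⟩
      rcases t with u | w
      · rcases hpt : ρ.parent (Sum.inl u) with v | w
        · refine (HasColoring.empty _ _ _ K).mono ?_ le_rfl le_rfl le_rfl
          rintro p ⟨hp, hup⟩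
          obtain ⟨q, h1, h2⟩ := hnext p hp hup
          rw [hpt] at h2
          rcases p with p | p <;> rcases q with q | q
          · exact h1.elim
          · cases h2
          · cases hp
          · exact h1.elim
        · refine transfer₁ (u := u) (hK₁ (D.lab₁ u w)) ?_
          rintro p ⟨hp, hup⟩
          refine ⟨hp, ?_⟩
          obtain ⟨q, h1, h2⟩ := hnext p hp hup
          rw [hpt] at h2
          rcases p with ⟨v, x⟩ | p <;> rcases q with q | ⟨w', y⟩
          · exact h1.elim
          · cases hp
            cases h2
            exact h1.2.choose
          · cases hp
          · exact h1.elim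
      · rcases hpt : ρ.parent (Sum.inr w) with u | v
        · refine transfer₂ (w := w) (hK₂ (D.lab₂ w u)) ?_
          rintro p ⟨hp, hup⟩
          refine ⟨hp, ?_⟩
          obtain ⟨q, h1, h2⟩ := hnext p hp hup
          rw [hpt] at h2
          rcases p with p | ⟨w', y⟩ <;> rcases q with ⟨u', x⟩ | q
          · exact h1.elim
          · cases hp
          · cases hp
            cases h2
            obtain ⟨-, hx, hy⟩ := h1
            have hmem := Subtype.coe_prop (D.φ (D.lab₁ u' w') (D.lab₂ w' u') ⟨x, hx⟩)
            rwa [show (D.φ (D.lab₁ u' w') (D.lab₂ w' u') ⟨x, hx⟩ : V₂) = y from hy] at hmem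
          · exact h1.elim
        · refine (HasColoring.empty _ _ _ K).mono ?_ le_rfl le_rfl le_rfl
          rintro p ⟨hp, hup⟩
          obtain ⟨q, h1, h2⟩ := hnext p hp hup
          rw [hpt] at h2
          rcases p with p | p <;> rcases q with q | q
          · exact h1.elim
          · cases hp
          · cases h2
          · exact h1.elim
    · refine ⟨0, fun t => (HasColoring.empty _ _ _ 0).mono ?_ le_rfl le_rfl le_rfl⟩
      rintro p ⟨-, hup⟩
      exact absurd (exists_adj_of_bonds_adj (RootedTreeOfGraphs.up_spec hup).1) hE

end AmalgamData

/-! ### The bound for tree amalgamations -/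

theorem theorem1 {V₁ V₂ I₁ I₂ W₁ W₂ Γ₁ Γ₂ : Type*}
    [Group Γ₁] [MulAction Γ₁ V₁] [Group Γ₂] [MulAction Γ₂ V₂]
    (G₁ : SimpleGraph V₁) (G₂ : SimpleGraph V₂)
    (hfin₁ : ∀ x, (G₁.neighborSet x).Finite) (hfin₂ : ∀ x, (G₂.neighborSet x).Finite)
    (hconn₁ : G₁.Connected) (hconn₂ : G₂.Connected)
    (hact₁ : ActsQuasiTransitively Γ₁ G₁) (hact₂ : ActsQuasiTransitively Γ₂ G₂)
    (D : AmalgamData V₁ V₂ I₁ I₂ W₁ W₂)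
    (hident : D.FiniteIdentification)
    (hresp : D.RespectsActions G₁ G₂ Γ₁ Γ₂) :
    (∀ k : I₁, graphAsdim (D.amalgam G₁ G₂) ≤
      max (max (graphAsdim G₁) (graphAsdim G₂)) (setAsdim G₁ (D.S₁ k) + 1)) ∧
    (∀ l : I₂, graphAsdim (D.amalgam G₁ G₂) ≤
      max (max (graphAsdim G₁) (graphAsdim G₂)) (setAsdim G₂ (D.S₂ l) + 1)) ∧
    (∀ (u : W₁) (k : I₁), graphAsdim (D.amalgam G₁ G₂) ≤
      max (max (graphAsdim G₁) (graphAsdim G₂))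
        (setAsdim (D.amalgam G₁ G₂) (D.image₁ u k) + 1)) ∧
    (∀ (w : W₂) (l : I₂), graphAsdim (D.amalgam G₁ G₂) ≤
      max (max (graphAsdim G₁) (graphAsdim G₂))
        (setAsdim (D.amalgam G₁ G₂) (D.image₂ w l) + 1)) := by
  have main : ∀ s : ℕ∞, (s ≠ ⊤ → ∃ e : ℕ, (e : ℕ∞) ≤ s ∧
      ((∃ k, ∀ r, ∃ K, G₁.HasColoring (D.S₁ k) (e + 1) r K) ∨
        ∃ l, ∀ r, ∃ K, G₂.HasColoring (D.S₂ l) (e + 1) r K)) →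
      graphAsdim (D.amalgam G₁ G₂) ≤ max (max (graphAsdim G₁) (graphAsdim G₂)) (s + 1) := by
    intro s hs
    rcases eq_or_ne (max (max (graphAsdim G₁) (graphAsdim G₂)) (s + 1)) ⊤ with htop | htop
    · rw [htop]; exact le_top
    simp only [ne_eq, max_eq_top, not_or] at htop
    obtain ⟨a, ha, hca⟩ := SimpleGraph.exists_hasColoring_of_graphAsdim_ne_top htop.1.1
    obtain ⟨b, hb, hcb⟩ := SimpleGraph.exists_hasColoring_of_graphAsdim_ne_top htop.1.2
    obtain ⟨e, he, hce⟩ := hs fun h => htop.2 (by rw [h]; rfl)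
    -- The adhesion set is coloured with `e + 1 ≤ n` colours, one fewer than the `n + 1` available
    -- for the parts.
    set n := max (max a b) (e + 1) with hn
    have key := hresp.asdimLE_amalgam hfin₁ hfin₂ hconn₁ hconn₂ hact₁ hact₂ hident (n := n)
      (fun r => (hca r).imp fun K hK => hK.mono subset_rfl (by omega) le_rfl le_rfl)
      (fun r => (hcb r).imp fun K hK => hK.mono subset_rfl (by omega) le_rfl le_rfl)
      (hce.imp
        (fun ⟨k, h⟩ => ⟨k, fun r => (h r).imp fun K hK =>
          hK.mono subset_rfl (by omega) le_rfl le_rfl⟩)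
        (fun ⟨l, h⟩ => ⟨l, fun r => (h r).imp fun K hK =>
          hK.mono subset_rfl (by omega) le_rfl le_rfl⟩))
    calc graphAsdim (D.amalgam G₁ G₂) ≤ (n : ℕ∞) := iInf₂_le n key
      _ = max (max (a : ℕ∞) b) (e + 1) := by rw [hn]; rfl
      _ ≤ _ := by gcongr
  obtain ⟨ρ⟩ := hident.nonempty_rooting
  obtain ⟨hbond, -⟩ := hresp.coarseBonds_and_hasColoring hfin₁ hfin₂ hconn₁ hconn₂ hact₁ hact₂
    hident ρ
  refine ⟨fun k => main _ fun h => ?_, fun l => main _ fun h => ?_, fun u k => main _ fun h => ?_,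
    fun w l => main _ fun h => ?_⟩
  · obtain ⟨e, he, hc⟩ := SimpleGraph.exists_hasColoring_of_setAsdim_ne_top h
    exact ⟨e, he, Or.inl ⟨k, hc⟩⟩
  · obtain ⟨e, he, hc⟩ := SimpleGraph.exists_hasColoring_of_setAsdim_ne_top h
    exact ⟨e, he, Or.inr ⟨l, hc⟩⟩
  · obtain ⟨e, he, hc⟩ := SimpleGraph.exists_hasColoring_of_setAsdim_ne_top h
    refine ⟨e, he, Or.inl ⟨k, fun r => ?_⟩⟩
    obtain ⟨K, hK⟩ := hc r
    -- The contraction map does not increase distances on a copy and embeds it coarsely, so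
    -- colourings of the image pull back to the adhesion set in `G₁`.
    obtain ⟨K', hK'⟩ := hbond.exists_copy_within K
    refine ⟨K', hK.transfer (fun x => D.proj (Sum.inl (u, x))) (fun x hx => ⟨x, hx, rfl⟩)
      (fun x _ y _ hxy => ?_) (fun x _ y _ hxy => ?_)⟩
    · have hcopy : (D.copies G₁ G₂).Within r (Sum.inl (u, x)) (Sum.inl (u, y)) :=
        AmalgamData.copies_within_inl_iff.2 ⟨rfl, hxy⟩
      exact (D.rooted G₁ G₂ ρ).cls_within hcopy
    · exact ((AmalgamData.copies_within_inl_iff (D := D)).1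
        (hK' (Sum.inl (u, x)) (Sum.inl (u, y)) rfl hxy)).2
  · obtain ⟨e, he, hc⟩ := SimpleGraph.exists_hasColoring_of_setAsdim_ne_top h
    refine ⟨e, he, Or.inr ⟨l, fun r => ?_⟩⟩
    obtain ⟨K, hK⟩ := hc r
    obtain ⟨K', hK'⟩ := hbond.exists_copy_within K
    refine ⟨K', hK.transfer (fun y => D.proj (Sum.inr (w, y))) (fun y hy => ⟨y, hy, rfl⟩)
      (fun x _ y _ hxy => ?_) (fun x _ y _ hxy => ?_)⟩
    · have hcopy : (D.copies G₁ G₂).Within r (Sum.inr (w, x)) (Sum.inr (w, y)) :=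
        AmalgamData.copies_within_inr_iff.2 ⟨rfl, hxy⟩
      exact (D.rooted G₁ G₂ ρ).cls_within hcopy
    · exact ((AmalgamData.copies_within_inr_iff (D := D)).1
        (hK' (Sum.inr (w, x)) (Sum.inr (w, y)) rfl hxy)).2
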